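/- Let $n\ge 2$, let $(z_1,\dots,z_n)$ be the standard complex coordinates of $\mathbb{C}^n$, and let $V^{p,q}$ be the space of constant coefficient $(p,q)$ forms on $\mathbb{C}^n$. A form $\omega\in V^{1,1}$ is a Kähler form if $\omega=\sum_{l=1}^n\frac{\sqrt{-1}}{2}dw_l\wedge d\overline{w_l}$ in some complex linear coordinates $(w_1,\dots,w_n)$. Let $M=(\alpha_{i,j})$ be a $2\times2$ matrix with entries in $V^{1,1}$ such that - $M$ is Griffiths positive, i.e. $\alpha_{i,j}=\overline{\alpha_{j,i}}$ and $\sum_{i,j}\theta_i\overline{\theta_j}\,\alpha_{i,j}$ is a Kähler form for every $\theta\in\mathbb{C}^2\setminus\{0\}$; - all entries of $M$ are diagonalized, i.e. $\alpha_{i,j}=\sum_{l=1}^n b_{i,j}^{(l)}\frac{\sqrt{-1}}{2}dz_l\wedge d\overline{z_l}$ with $b_{i,j}^{(l)}\in\mathbb{C}$. Put $\Omega=\det(M)\in V^{2,2}$. For a form $\Omega\in V^{k,k}$, a Kähler form $\omega$ and $p,q\ge0$ with $p+q=n-k$, set $$P^{p,q}=\{\alpha\in V^{p,q}:\alpha\wedge\Omega\wedge\omega=0\},\qquad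 Q(\alpha,\beta)=(\sqrt{-1})^{p-q}(-1)^{\frac{(p+q)(p+q-1)}2}\star(\alpha\wedge\overline\beta\wedge\Omega),$$ where $\star$ of a top degree form is its coefficient with respect to $\mathrm{Vol}=\bigwedge_{l=1}^n\frac{\sqrt{-1}}2dz_l\wedge d\overline{z_l}$. One says that, for the bidegree $(p,q)$, $\Omega$ satisfies - HLT (or is a Lefschetz form) if $\alpha\mapsto\alpha\wedge\Omega$ is an isomorphism $V^{p,q}\to V^{n-q,n-p}$; - HRR (with respect to $\omega$) if $Q$ is positive definite on $P^{p,q}$; - LD (with respect to $\omega$) if $V^{p,q}=(\omega\wedge V^{p-1,q-1})\oplus P^{p,q}$ and this decomposition is orthogonal for $Q$ (with $V^{p-1,q-1}=0$ if $p=0$ or $q=0$). A real form $\Omega\in V^{k,k}$ is Hodge–Riemann (with respect to $\omega$) if for all $p,q\ge 0$ with $p+q=n-k$ there is a continuous path of real forms $\Omega_t\in V^{k,k}$, $0\le t\le1$, with $\Omega_0=\Omega$ and $\Omega_1=\omega^k$, such that $\Omega_t\wedge\omega^{2r}$ is a Lefschetz form for the bidegree $(p-r,q-r)$ for all $0\le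 r\le\min\{p,q\}$ and $0\le t\le1$. **Theorem.** 1. If $n\le5$, then for every Kähler form $\omega$, $\Omega=\det(M)$ satisfies HLT, HRR and LD for all bidegrees $(p,q)$ with $p+q=n-2$; moreover $\Omega$ is a Hodge–Riemann form with respect to $\omega$. 2. If $n\ge4$, then $\Omega$ satisfies HLT for the bidegrees $(n-2,0)$, $(n-3,1)$, $(1,n-3)$ and $(0,n-2)$. -/

import Mathlib

open scoped ComplexConjugate

noncomputable section

namespace ConstForm

/-- The complexified cotangent space of `ℂⁿ`, i.e. `V ⊕ V̄`: the pair `(a, b)` stands for the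
covector `∑ a_j dz_j + ∑ b_j dz̄_j`. -/
abbrev Covec (n : ℕ) : Type := (Fin n → ℂ) × (Fin n → ℂ)

/-- The algebra of constant coefficient complex differential forms on `ℂⁿ`; its product is the
wedge product. -/
abbrev Form (n : ℕ) : Type := ExteriorAlgebra ℂ (Covec n)

/-- The `(1,0)` form `∑ a_j dz_j`, as a linear function of `a`. -/
def hol (n : ℕ) : (Fin n → ℂ) →ₗ[ℂ] Form n :=
  (ExteriorAlgebra.ι ℂ).comp (LinearMap.inl ℂ (Fin n → ℂ) (Fin n → ℂ))

/-- The `(0,1)` form `∑ b_j dz̄_j`, as a linear function of `b`. -/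
def antihol (n : ℕ) : (Fin n → ℂ) →ₗ[ℂ] Form n :=
  (ExteriorAlgebra.ι ℂ).comp (LinearMap.inr ℂ (Fin n → ℂ) (Fin n → ℂ))

/-- `dz_l`. -/
def dz {n : ℕ} (l : Fin n) : Form n := hol n (Pi.single l 1)

/-- `dz̄_l`. -/
def dzbar {n : ℕ} (l : Fin n) : Form n := antihol n (Pi.single l 1)

/-- The space `V^{p,q}` of forms of bidegree `(p,q)`: the span of the products of `p` forms of
type `(1,0)` followed by `q` forms of type `(0,1)`. -/
def bidegree (n p q : ℕ) : Submodule ℂ (Form n) :=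
  LinearMap.range (hol n) ^ p * LinearMap.range (antihol n) ^ q

/-! Complex conjugation of forms. -/

/-- The ring of forms with the conjugate complex structure. -/
def ConjCopy (n : ℕ) : Type := Form n

instance (n : ℕ) : Ring (ConjCopy n) := inferInstanceAs (Ring (Form n))

/-- In `ConjCopy n` a scalar `c` acts as `c̄` does in `Form n`. -/
instance (n : ℕ) : Algebra ℂ (ConjCopy n) :=
  RingHom.toAlgebra' ((algebraMap ℂ (Form n)).comp (starRingEnd ℂ))
    fun c x => Algebra.commutes (A := Form n) (conj c) x

/-- The conjugate `∑ b̄_j dz_j + ∑ ā_j dz̄_j` of the covector `∑ a_j dz_j + ∑ b_j dz̄_j`. -/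
def conjCovec {n : ℕ} (w : Covec n) : Covec n :=
  (fun j => conj (w.2 j), fun j => conj (w.1 j))

/-- Conjugation of covectors, as a complex linear map into `ConjCopy n`. -/
def conjι (n : ℕ) : Covec n →ₗ[ℂ] ConjCopy n where
  toFun w := (ExteriorAlgebra.ι ℂ (conjCovec w) : Form n)
  map_add' v w := by
    have h : conjCovec (v + w) = conjCovec v + conjCovec w := by
      ext j <;> simp [conjCovec]
    rw [h]
    exact map_add (ExteriorAlgebra.ι ℂ) _ _
  map_smul' c w := by
    have h : conjCovec (c • w) = conj c • conjCovec w := by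
      ext j <;> simp [conjCovec]
    rw [h, Algebra.smul_def]
    exact (map_smul (ExteriorAlgebra.ι ℂ) _ _).trans (Algebra.smul_def (A := Form n) _ _)

/-- Complex conjugation `α ↦ ᾱ` of forms: the conjugate linear ring homomorphism that exchanges
`dz_l` and `dz̄_l`. -/
def conjForm (n : ℕ) : Form n →+* Form n :=
  ((ExteriorAlgebra.lift ℂ ⟨conjι n, fun w => ExteriorAlgebra.ι_sq_zero (conjCovec w)⟩ :
    Form n →ₐ[ℂ] ConjCopy n) : Form n →+* ConjCopy n)

theorem conjForm_ι {n : ℕ} (w : Covec n) :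
    conjForm n (ExteriorAlgebra.ι ℂ w) = ExteriorAlgebra.ι ℂ (conjCovec w) :=
  ExteriorAlgebra.lift_ι_apply ℂ (conjι n) _ w

theorem conjForm_smul {n : ℕ} (c : ℂ) (x : Form n) :
    conjForm n (c • x) = conj c • conjForm n x := by
  rw [Algebra.smul_def, Algebra.smul_def, map_mul]
  congr 1
  exact AlgHom.commutes (ExteriorAlgebra.lift ℂ
    ⟨conjι n, fun w => ExteriorAlgebra.ι_sq_zero (conjCovec w)⟩ : Form n →ₐ[ℂ] ConjCopy n) c

/-- `V_l = (√-1 / 2) dz_l ∧ dz̄_l`. -/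
def areaForm {n : ℕ} (l : Fin n) : Form n := (Complex.I / 2) • (dz l * dzbar l)

/-- `Vol = V_1 ∧ ⋯ ∧ V_n`. -/
def vol (n : ℕ) : Form n := (List.ofFn fun l : Fin n => areaForm l).prod

/-- The basis `dz_1, dz̄_1, dz_2, dz̄_2, …, dz_n, dz̄_n` of the space of covectors. -/
def covecBasis (n : ℕ) : Module.Basis (Fin (n * 2)) ℂ (Covec n) :=
  ((Pi.basisFun ℂ (Fin n)).prod (Pi.basisFun ℂ (Fin n))).reindex
    ((((Equiv.boolProdEquivSum (Fin n)).symm.trans (Equiv.prodComm Bool (Fin n))).trans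
      (Equiv.prodCongr (Equiv.refl (Fin n)) finTwoEquiv.symm)).trans finProdFinEquiv)

theorem covecBasis_zero {n : ℕ} (l : Fin n) :
    covecBasis n (finProdFinEquiv (l, 0)) = (Pi.single l 1, 0) := by
  simp only [covecBasis, Module.Basis.reindex_apply, Equiv.symm_trans_apply,
    Equiv.symm_apply_apply]
  simp [finTwoEquiv]

theorem covecBasis_one {n : ℕ} (l : Fin n) :
    covecBasis n (finProdFinEquiv (l, 1)) = (0, Pi.single l 1) := by
  simp only [covecBasis, Module.Basis.reindex_apply, Equiv.symm_trans_apply,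
    Equiv.symm_apply_apply]
  simp [finTwoEquiv]

/-- The Hodge star of the top degree part of a form: the linear functional that vanishes on forms
of degree different from `2n` and maps `Vol` to `1`. -/
def starTop (n : ℕ) : Form n →ₗ[ℂ] ℂ :=
  (-2 * Complex.I) ^ n • ExteriorAlgebra.liftAlternating
    (Pi.single (M := fun i => Covec n [⋀^Fin i]→ₗ[ℂ] ℂ) (n * 2) (covecBasis n).det)

theorem prod_ofFn_smul {A : Type*} [Ring A] [Algebra ℂ A] (c : ℂ) :
    ∀ (n : ℕ) (f : Fin n → A),
      (List.ofFn fun l => c • f l).prod = c ^ n • (List.ofFn f).prod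
  | 0, f => by simp
  | n + 1, f => by
    simp only [List.ofFn_succ, List.prod_cons]
    rw [prod_ofFn_smul c n fun l => f l.succ, smul_mul_smul_comm, pow_succ']

theorem vol_eq (n : ℕ) :
    vol n = (Complex.I / 2) ^ n • ExteriorAlgebra.ιMulti ℂ (n * 2) (covecBasis n) := by
  rw [ExteriorAlgebra.ιMulti_apply, List.ofFn_mul, List.prod_flatten, List.map_ofFn, vol]
  unfold areaForm
  rw [prod_ofFn_smul]
  congr 3
  funext l
  have h0 : (⟨l * 2 + (0 : Fin 2), by simp⟩ : Fin (n * 2)) = finProdFinEquiv (l, 0) := by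
    ext; simp [finProdFinEquiv]; ring
  have h1 : (⟨l * 2 + (1 : Fin 2), by simp; omega⟩ : Fin (n * 2)) = finProdFinEquiv (l, 1) := by
    ext; simp [finProdFinEquiv]; ring
  simp only [Function.comp_apply, List.ofFn_succ, List.ofFn_zero, List.prod_cons, List.prod_nil,
    Fin.succ_zero_eq_one, mul_one]
  rw [h0, h1, covecBasis_zero, covecBasis_one]
  rfl

/-- The normalization of `starTop`. -/
theorem starTop_vol (n : ℕ) : starTop n (vol n) = 1 := by
  rw [vol_eq, starTop, map_smul, LinearMap.smul_apply,
    ExteriorAlgebra.liftAlternating_apply_ιMulti, Pi.single_eq_same, Module.Basis.det_self,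
    smul_eq_mul, smul_eq_mul, mul_one, ← mul_pow]
  have h : Complex.I / 2 * (-2 * Complex.I) = 1 := by
    linear_combination -Complex.I_mul_I
  rw [h, one_pow]

/-- `ω` is a Kähler form: `ω = ∑ (√-1 / 2) dw_l ∧ dw̄_l` in some complex coordinates
`(w_1, …, w_n)`, where `dw_l = ∑_j w_{l,j} dz_j` form a basis of `V`. -/
def IsKahler {n : ℕ} (ω : Form n) : Prop :=
  ∃ w : Module.Basis (Fin n) ℂ (Fin n → ℂ),
    ω = ∑ l, (Complex.I / 2) • (hol n (w l) * conjForm n (hol n (w l)))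

/-- The determinant of a matrix of `(1,1)` forms (these commute with each other, so the order of
the factors does not matter). -/
def formDet {n k : ℕ} (M : Matrix (Fin k) (Fin k) (Form n)) : Form n :=
  ∑ σ : Equiv.Perm (Fin k),
    ((Equiv.Perm.sign σ : ℤ) : ℂ) • (List.ofFn fun i => M i (σ i)).prod

/-- Griffiths positivity of a `k × k` matrix `M` of `(1,1)` forms: `M` is Hermitian and
`θ M θ̄ᵗ` is a Kähler form for every nonzero `θ ∈ ℂᵏ`. -/
structure IsGriffithsPositive {n k : ℕ} (M : Matrix (Fin k) (Fin k) (Form n)) : Prop where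
  mem : ∀ i j, M i j ∈ bidegree n 1 1
  hermitian : ∀ i j, M i j = conjForm n (M j i)
  kahler : ∀ θ : Fin k → ℂ, θ ≠ 0 → IsKahler (∑ i, ∑ j, (θ i * conj (θ j)) • M i j)

/-- All entries are diagonalized: they are linear combinations of the `(√-1/2) dz_l ∧ dz̄_l`. -/
def HasDiagonalizedEntries {n k : ℕ} (M : Matrix (Fin k) (Fin k) (Form n)) : Prop :=
  ∃ b : Fin k → Fin k → Fin n → ℂ, ∀ i j, M i j = ∑ l, b i j l • areaForm l

/-- HLT: the `(k,k)` form `Ω` with `k = n - p - q` is a Lefschetz form for the bidegree `(p,q)`,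
i.e. `α ↦ α ∧ Ω` is an isomorphism from `V^{p,q}` onto `V^{n-q,n-p}`. -/
def IsLefschetz {n : ℕ} (Ω : Form n) (p q : ℕ) : Prop :=
  p + q ≤ n ∧ Ω ∈ bidegree n (n - p - q) (n - p - q) ∧
    Set.BijOn (fun α => α * Ω) (bidegree n p q) (bidegree n (n - q) (n - p))

/-- `Q(α, β) = (√-1)^{p-q} (-1)^{(p+q)(p+q-1)/2} ⋆(α ∧ β̄ ∧ Ω)` on `V^{p,q}`. -/
def hodgeForm {n : ℕ} (Ω : Form n) (p q : ℕ) (α β : Form n) : ℂ :=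
  Complex.I ^ ((p : ℤ) - (q : ℤ)) * (-1) ^ ((p + q) * (p + q - 1) / 2) *
    starTop n (α * conjForm n β * Ω)

/-- The primitive space `P^{p,q} = {α ∈ V^{p,q} | α ∧ Ω ∧ ω = 0}`. -/
def primitive {n : ℕ} (Ω ω : Form n) (p q : ℕ) : Submodule ℂ (Form n) :=
  bidegree n p q ⊓ LinearMap.ker (LinearMap.mulRight ℂ (Ω * ω))

/-- `ω ∧ V^{p-1,q-1}`, which is zero if `p = 0` or `q = 0`. -/
def lefschetzImage {n : ℕ} (ω : Form n) (p q : ℕ) : Submodule ℂ (Form n) :=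
  if 1 ≤ p ∧ 1 ≤ q then (bidegree n (p - 1) (q - 1)).map (LinearMap.mulLeft ℂ ω) else ⊥

/-- HRR: `Q` is positive definite on the primitive space. -/
def SatisfiesHRR {n : ℕ} (Ω ω : Form n) (p q : ℕ) : Prop :=
  ∀ α ∈ primitive Ω ω p q, α ≠ 0 →
    0 < (hodgeForm Ω p q α α).re ∧ (hodgeForm Ω p q α α).im = 0

/-- LD: `V^{p,q}` is the direct sum of `ω ∧ V^{p-1,q-1}` and the primitive space, and the sum is
orthogonal with respect to `Q`. -/
def SatisfiesLD {n : ℕ} (Ω ω : Form n) (p q : ℕ) : Prop :=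
  lefschetzImage ω p q ⊓ primitive Ω ω p q = ⊥ ∧
  lefschetzImage ω p q ⊔ primitive Ω ω p q = bidegree n p q ∧
  ∀ α ∈ lefschetzImage ω p q, ∀ β ∈ primitive Ω ω p q, hodgeForm Ω p q α β = 0

/-- Real forms of bidegree `(k,k)`. -/
def IsRealForm {n : ℕ} (k : ℕ) (Ω : Form n) : Prop :=
  Ω ∈ bidegree n k k ∧ conjForm n Ω = Ω

/-- `Ω` is a Hodge-Riemann form for the bidegree `(p,q)` with respect to `ω`, where
`k = n - p - q`: a continuous path of real `(k,k)` forms joins `Ω` to `ω^k`, and `Ω_t ∧ ω^{2r}` is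
Lefschetz for `(p-r,q-r)` along it. Continuity refers to the usual topology of a finite
dimensional space, so it is tested by the linear functionals. -/
def IsHodgeRiemannAt {n : ℕ} (ω Ω : Form n) (k p q : ℕ) : Prop :=
  p + q + k = n ∧
  ∃ Ωt : ℝ → Form n,
    (∀ φ : Form n →ₗ[ℂ] ℂ, ContinuousOn (fun t => φ (Ωt t)) (Set.Icc 0 1)) ∧
    (∀ t ∈ Set.Icc (0 : ℝ) 1, IsRealForm k (Ωt t)) ∧
    Ωt 0 = Ω ∧ Ωt 1 = ω ^ k ∧
    ∀ t ∈ Set.Icc (0 : ℝ) 1, ∀ r ≤ min p q, IsLefschetz (Ωt t * ω ^ (2 * r)) (p - r) (q - r)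

/-- `Ω` is a Hodge-Riemann `(k,k)` form with respect to `ω`. -/
def IsHodgeRiemann {n : ℕ} (ω Ω : Form n) (k : ℕ) : Prop :=
  IsRealForm k Ω ∧ ∀ p q : ℕ, p + q + k = n → IsHodgeRiemannAt ω Ω k p q

end ConstForm

end

open ConstForm

/-!
Let `M = ∑ B_l V_l` with `V_l = (√-1/2) dz_l ∧ dz̄_l`. Griffiths positivity says that the `2 × 2`
matrices `B_l` are positive definite Hermitian, and then `det M = ½ ∑ c_{kl} V_k ∧ V_l`, where
`c_{kl} > 0` is twice the mixed discriminant of `B_k` and `B_l`. For `p + q = n - 2` with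
`min p q ≤ 1`, which covers all the bidegrees of the theorem, the Hodge form is computed explicitly.

If `q = 0`, it is a sum of squares with weights `c_{kl}`. If `q = 1`, write `α = ∑ β_j ∧ w̄_j` and
let `h_j(k,l,m)` be the coefficient of the `(n,0)` form `β_j ∧ w_k ∧ w_l ∧ w_m`; up to a positive
factor `Q(α,α)` is `∑ c_{kl} h_j(j',k,l) h̄_{j'}(j,k,l)`. The quadruples `(j,j',k,l)` with a repeated index
contribute nonnegative terms. A set of four distinct indices contributes minus the Hermitian form
`∑ c_{kl} f_i f̄_j` in four variables, with `{k,l}` complementary to `{i,j}`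
(`sum_perm_pairTerm`). A diagonal change of variables replaces `c_{kl}` by `c_{ij}`, and
`∑_{i,j} c_{ij} g_i ḡ_j = |tr X|² - ‖X‖²` for `X = ∑ g_i B_i`. Since the diagonal terms
`c_{ii} |g_i|²` are positive, the part with `i ≠ j` is negative definite on the hyperplane `tr X = 0`
(`PosHerm.sum_mixed_le`, `exists_complForm_neg`). Hence `Q` is positive definite on a
subspace of `V^{n-3,1}` of codimension at most `n.choose 4` (`exists_hyperplanes`).

On the other hand, for every Kähler form `ω`, `Q` is negative definite on `ω ∧ V^{n-4,0}`, of
dimension `n.choose 4` (`starTop_kahler_sq_discForm`), and the primitive space is orthogonal to it.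
Comparing signatures gives HRR (`satisfiesHRR_discForm_one`). HRR gives the injectivity in HLT, and
surjectivity is a dimension count by Poincaré duality (`isLefschetz_of_injective`). LD holds because
`det M ∧ ω²` is Lefschetz on `V^{n-4,0}`. The bidegrees with `p < q` follow by conjugation.

For the Hodge-Riemann property, the matrices `B_l` are moved linearly to the identity, which deforms
`det M` to the square of `∑ V_l`, and that Kähler form is moved linearly to `ω`. The square of a
Kähler form is the determinant of a diagonal matrix in the coordinates of that form. Therefore all
computations are made with respect to an arbitrary basis `w` of the space of `(1,0)` covectors.
-/

namespace ConstForm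

open scoped ComplexOrder

variable {n : ℕ}

/-! ### The algebra of forms -/

theorem hol_mul_hol (a b : Fin n → ℂ) : hol n a * hol n b = -(hol n b * hol n a) :=
  eq_neg_of_add_eq_zero_left (ExteriorAlgebra.ι_add_mul_swap _ _)

theorem hol_mul_antihol (a b : Fin n → ℂ) :
    hol n a * antihol n b = -(antihol n b * hol n a) :=
  eq_neg_of_add_eq_zero_left (ExteriorAlgebra.ι_add_mul_swap _ _)

theorem antihol_mul_hol (a b : Fin n → ℂ) :
    antihol n a * hol n b = -(hol n b * antihol n a) :=
  eq_neg_of_add_eq_zero_left (ExteriorAlgebra.ι_add_mul_swap _ _)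

theorem conjForm_hol (a : Fin n → ℂ) :
    conjForm n (hol n a) = antihol n (fun j => conj (a j)) := by
  simp only [hol, antihol, LinearMap.comp_apply, conjForm_ι]
  congr 1
  ext j <;> simp [conjCovec]

theorem conjForm_antihol (a : Fin n → ℂ) :
    conjForm n (antihol n a) = hol n (fun j => conj (a j)) := by
  simp only [hol, antihol, LinearMap.comp_apply, conjForm_ι]
  congr 1
  ext j <;> simp [conjCovec]

theorem conjForm_algebraMap (c : ℂ) :
    conjForm n (algebraMap ℂ (Form n) c) = algebraMap ℂ (Form n) (conj c) := by
  rw [Algebra.algebraMap_eq_smul_one, conjForm_smul, map_one, Algebra.algebraMap_eq_smul_one]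

theorem conjForm_conjForm (x : Form n) : conjForm n (conjForm n x) = x := by
  induction x using ExteriorAlgebra.induction with
  | algebraMap r => simp [conjForm_algebraMap]
  | ι w =>
    rw [conjForm_ι, conjForm_ι]
    congr 1
    ext j <;> simp [conjCovec]
  | mul a b ha hb => rw [map_mul, map_mul, ha, hb]
  | add a b ha hb => rw [map_add, map_add, ha, hb]

theorem conjForm_injective : Function.Injective (conjForm n) :=
  Function.LeftInverse.injective conjForm_conjForm

theorem hol_mem (a : Fin n → ℂ) : hol n a ∈ bidegree n 1 0 := by
  simp [bidegree]

theorem antihol_mem (a : Fin n → ℂ) : antihol n a ∈ bidegree n 0 1 := by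
  simp [bidegree]

theorem one_mem_bidegree : (1 : Form n) ∈ bidegree n 0 0 := by
  simp [bidegree]

theorem range_hol_commute_range_antihol :
    Commute (LinearMap.range (hol n)) (LinearMap.range (antihol n)) := by
  apply le_antisymm
  · rw [Submodule.mul_le]
    rintro _ ⟨a, rfl⟩ _ ⟨b, rfl⟩
    rw [hol_mul_antihol]
    exact neg_mem (Submodule.mul_mem_mul ⟨b, rfl⟩ ⟨a, rfl⟩)
  · rw [Submodule.mul_le]
    rintro _ ⟨a, rfl⟩ _ ⟨b, rfl⟩
    rw [antihol_mul_hol]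
    exact neg_mem (Submodule.mul_mem_mul ⟨b, rfl⟩ ⟨a, rfl⟩)

theorem bidegree_mul (p q r s : ℕ) :
    bidegree n p q * bidegree n r s = bidegree n (p + r) (q + s) := by
  unfold bidegree
  rw [mul_assoc, ← mul_assoc (_ ^ q), ← (range_hol_commute_range_antihol.pow_pow r q).eq,
    pow_add, pow_add]
  simp only [mul_assoc]

theorem mul_mem_bidegree {p q r s : ℕ} {x y : Form n} (hx : x ∈ bidegree n p q)
    (hy : y ∈ bidegree n r s) : x * y ∈ bidegree n (p + r) (q + s) := by
  rw [← bidegree_mul]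
  exact Submodule.mul_mem_mul hx hy

theorem mul_mem_bidegree' {p q r s a b : ℕ} {x y : Form n} (hx : x ∈ bidegree n p q)
    (hy : y ∈ bidegree n r s) (ha : p + r = a) (hb : q + s = b) : x * y ∈ bidegree n a b := by
  subst ha hb
  exact mul_mem_bidegree hx hy

theorem map_conj_pow (A : Submodule ℂ (Form n)) {B : Submodule ℂ (Form n)}
    (h : ∀ x ∈ A, conjForm n x ∈ B) (k : ℕ) : ∀ x ∈ A ^ k, conjForm n x ∈ B ^ k := by
  induction k with
  | zero =>
    intro x hx
    rw [pow_zero] at hx ⊢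
    obtain ⟨c, rfl⟩ := Submodule.mem_one.1 hx
    rw [conjForm_algebraMap]
    exact Submodule.mem_one.2 ⟨_, rfl⟩
  | succ k ih =>
    intro x hx
    rw [pow_succ] at hx ⊢
    induction hx using Submodule.mul_induction_on' with
    | mem_mul_mem a ha b hb =>
      rw [map_mul]
      exact Submodule.mul_mem_mul (ih a ha) (h b hb)
    | add a _ b _ ha hb =>
      rw [map_add]
      exact add_mem ha hb

theorem conjForm_mem_bidegree {p q : ℕ} {x : Form n} (hx : x ∈ bidegree n p q) :
    conjForm n x ∈ bidegree n q p := by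
  unfold bidegree at hx ⊢
  rw [(range_hol_commute_range_antihol.pow_pow q p).eq]
  induction hx using Submodule.mul_induction_on' with
  | mem_mul_mem a ha b hb =>
    rw [map_mul]
    refine Submodule.mul_mem_mul (map_conj_pow _ ?_ p a ha) (map_conj_pow _ ?_ q b hb)
    · rintro _ ⟨v, rfl⟩
      exact ⟨_, (conjForm_hol v).symm⟩
    · rintro _ ⟨v, rfl⟩
      exact ⟨_, (conjForm_antihol v).symm⟩
  | add a _ b _ ha hb =>
    rw [map_add]
    exact add_mem ha hb

/-! ### Graded commutativity -/

theorem bidegree_le_exteriorPower (p q : ℕ) : bidegree n p q ≤ ⋀[ℂ]^(p + q) (Covec n) := by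
  have h1 : LinearMap.range (hol n) ≤ LinearMap.range (ExteriorAlgebra.ι ℂ (M := Covec n)) :=
    LinearMap.range_comp_le_range _ _
  have h2 : LinearMap.range (antihol n) ≤ LinearMap.range (ExteriorAlgebra.ι ℂ (M := Covec n)) :=
    LinearMap.range_comp_le_range _ _
  unfold bidegree ExteriorAlgebra.exteriorPower
  rw [pow_add]
  exact mul_le_mul' (pow_le_pow_left' h1 p) (pow_le_pow_left' h2 q)

theorem exteriorPower_mul_ι {k : ℕ} {x : Form n} (hx : x ∈ ⋀[ℂ]^k (Covec n)) (v : Covec n) :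
    x * ExteriorAlgebra.ι ℂ v = (-1 : ℂ) ^ k • (ExteriorAlgebra.ι ℂ v * x) := by
  unfold ExteriorAlgebra.exteriorPower at hx
  induction k generalizing x with
  | zero =>
    rw [pow_zero] at hx
    obtain ⟨c, rfl⟩ := Submodule.mem_one.1 hx
    simp [Algebra.commutes]
  | succ k ih =>
    rw [pow_succ] at hx
    induction hx using Submodule.mul_induction_on' with
    | mem_mul_mem a ha b hb =>
      obtain ⟨w, rfl⟩ := hb
      have h : ExteriorAlgebra.ι ℂ w * ExteriorAlgebra.ι ℂ v =
          -(ExteriorAlgebra.ι ℂ v * ExteriorAlgebra.ι ℂ w) :=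
        eq_neg_of_add_eq_zero_left (ExteriorAlgebra.ι_add_mul_swap _ _)
      rw [mul_assoc, h, mul_neg, ← mul_assoc, ih ha, pow_succ]
      simp [mul_assoc]
    | add a _ b _ ha hb => rw [add_mul, ha, hb, mul_add, smul_add]

theorem exteriorPower_mul_comm {k m : ℕ} {x y : Form n} (hx : x ∈ ⋀[ℂ]^k (Covec n))
    (hy : y ∈ ⋀[ℂ]^m (Covec n)) : x * y = (-1 : ℂ) ^ (k * m) • (y * x) := by
  unfold ExteriorAlgebra.exteriorPower at hy
  induction m generalizing y with
  | zero =>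
    rw [pow_zero] at hy
    obtain ⟨c, rfl⟩ := Submodule.mem_one.1 hy
    simp [Algebra.commutes]
  | succ m ih =>
    rw [pow_succ] at hy
    induction hy using Submodule.mul_induction_on' with
    | mem_mul_mem a ha b hb =>
      obtain ⟨w, rfl⟩ := hb
      rw [← mul_assoc, ih ha, smul_mul_assoc, mul_assoc a x, exteriorPower_mul_ι hx,
        mul_smul_comm, smul_smul, ← pow_add, mul_assoc, Nat.mul_succ]
    | add a _ b _ ha hb => rw [add_mul, mul_add, ha, hb, smul_add]

theorem bidegree_mul_comm {p q r s : ℕ} {x y : Form n} (hx : x ∈ bidegree n p q)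
    (hy : y ∈ bidegree n r s) : x * y = (-1 : ℂ) ^ ((p + q) * (r + s)) • (y * x) :=
  exteriorPower_mul_comm (bidegree_le_exteriorPower _ _ hx) (bidegree_le_exteriorPower _ _ hy)

theorem mul_comm_of_mem_diag {k : ℕ} {y : Form n} (hy : y ∈ bidegree n k k) (x : Form n) :
    x * y = y * x := by
  induction x using ExteriorAlgebra.induction with
  | algebraMap c => exact Algebra.commutes c y
  | ι v =>
    rw [exteriorPower_mul_ι (bidegree_le_exteriorPower _ _ hy), Even.neg_one_pow ⟨k, rfl⟩, one_smul]
  | mul a b ha hb => rw [mul_assoc, hb, ← mul_assoc, ha, mul_assoc]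
  | add a b ha hb => rw [add_mul, mul_add, ha, hb]

/-! ### The degree operator and Poincaré duality -/

/-- Contraction of a form with the vector field `∂/∂z_l`. -/
noncomputable def contractHol (l : Fin n) : Form n →ₗ[ℂ] Form n :=
  CliffordAlgebra.contractLeft (Q := (0 : QuadraticForm ℂ (Covec n)))
    ((LinearMap.proj l).comp (LinearMap.fst ℂ (Fin n → ℂ) (Fin n → ℂ)))

theorem contractHol_hol_mul (l : Fin n) (v : Fin n → ℂ) (x : Form n) :
    contractHol l (hol n v * x) = v l • x - hol n v * contractHol l x :=
  CliffordAlgebra.contractLeft_ι_mul _ _ _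

theorem contractHol_antihol_mul (l : Fin n) (v : Fin n → ℂ) (x : Form n) :
    contractHol l (antihol n v * x) = -(antihol n v * contractHol l x) := by
  have h := CliffordAlgebra.contractLeft_ι_mul (Q := (0 : QuadraticForm ℂ (Covec n)))
    ((LinearMap.proj l).comp (LinearMap.fst ℂ (Fin n → ℂ) (Fin n → ℂ)))
    ((0, v) : Covec n) x
  rw [← zero_sub]
  refine h.trans ?_
  congr 1
  simp

theorem contractHol_algebraMap (l : Fin n) (c : ℂ) :
    contractHol l (algebraMap ℂ (Form n) c) = 0 :=
  CliffordAlgebra.contractLeft_algebraMap (Q := (0 : QuadraticForm ℂ (Covec n))) _ c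

theorem hol_eq_sum (v : Fin n → ℂ) : hol n v = ∑ l, v l • dz l := by
  conv_lhs => rw [pi_eq_sum_univ' v]
  rw [map_sum]
  refine Finset.sum_congr rfl fun l _ => ?_
  rw [map_smul]
  rfl

/-- The operator `∑ dz_l ∧ ι_{∂/∂z_l}`, which is multiplication by `p` on `V^{p,q}`. -/
noncomputable def holDegree (n : ℕ) : Form n →ₗ[ℂ] Form n :=
  ∑ l, (LinearMap.mulLeft ℂ (dz l)).comp (contractHol l)

theorem holDegree_apply (x : Form n) : holDegree n x = ∑ l, dz l * contractHol l x := by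
  simp [holDegree]

theorem holDegree_hol_mul (v : Fin n → ℂ) (x : Form n) :
    holDegree n (hol n v * x) = hol n v * x + hol n v * holDegree n x := by
  simp only [holDegree_apply, contractHol_hol_mul, mul_sub, Finset.sum_sub_distrib,
    mul_smul_comm]
  conv_rhs => rw [hol_eq_sum v, Finset.sum_mul]
  rw [sub_eq_add_neg, ← Finset.sum_neg_distrib]
  congr 1
  · simp
  · rw [← hol_eq_sum, Finset.mul_sum]
    refine Finset.sum_congr rfl fun l _ => ?_
    rw [← mul_assoc, ← mul_assoc, dz, hol_mul_hol v, neg_mul]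

theorem holDegree_antihol_mul (v : Fin n → ℂ) (x : Form n) :
    holDegree n (antihol n v * x) = antihol n v * holDegree n x := by
  simp only [holDegree_apply, contractHol_antihol_mul, Finset.mul_sum]
  refine Finset.sum_congr rfl fun l _ => ?_
  rw [mul_neg, ← mul_assoc, ← mul_assoc, dz, hol_mul_antihol, neg_mul, neg_neg]

theorem holDegree_of_mem {p q : ℕ} {x : Form n} (hx : x ∈ bidegree n p q) :
    holDegree n x = (p : ℂ) • x := by
  induction p generalizing x with
  | zero =>
    simp only [bidegree, pow_zero, one_mul] at hx
    simp only [Nat.cast_zero, zero_smul]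
    induction q generalizing x with
    | zero =>
      rw [pow_zero] at hx
      obtain ⟨c, rfl⟩ := Submodule.mem_one.1 hx
      simp [holDegree_apply, contractHol_algebraMap]
    | succ q ih =>
      rw [pow_succ'] at hx
      induction hx using Submodule.mul_induction_on' with
      | mem_mul_mem a ha b hb =>
        obtain ⟨v, rfl⟩ := ha
        rw [holDegree_antihol_mul, ih hb, mul_zero]
      | add a _ b _ ha hb => rw [map_add, ha, hb, add_zero]
  | succ p ih =>
    rw [bidegree, pow_succ', mul_assoc] at hx
    induction hx using Submodule.mul_induction_on' with
    | mem_mul_mem a ha b hb =>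
      obtain ⟨v, rfl⟩ := ha
      rw [holDegree_hol_mul, ih hb, mul_smul_comm, Nat.cast_succ, add_smul, one_smul, add_comm]
    | add a _ b _ ha hb => rw [map_add, ha, hb, smul_add]

/-- A form of type `(p,q)` with `p < n` that is killed by all `(1,0)` covectors is zero:
`∑ ι_l (dz_l ∧ x) = (n - p) x`. -/
theorem eq_zero_of_mul_hol {p q : ℕ} (hp : p < n) {x : Form n} (hx : x ∈ bidegree n p q)
    (w : Module.Basis (Fin n) ℂ (Fin n → ℂ)) (h : ∀ l, x * hol n (w l) = 0) : x = 0 := by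
  have h1 : ∀ v, hol n v * x = 0 := by
    intro v
    rw [bidegree_mul_comm (hol_mem v) hx, ← w.sum_repr v, map_sum, Finset.mul_sum,
      Finset.sum_eq_zero, smul_zero]
    intro l _
    rw [map_smul, mul_smul_comm, h, smul_zero]
  have h2 : ∀ l : Fin n, dz l * contractHol l x = x := by
    intro l
    have h3 := contractHol_hol_mul l (Pi.single l 1) x
    rw [h1, map_zero, Pi.single_eq_same, one_smul] at h3
    exact (sub_eq_zero.1 h3.symm).symm
  have h4 := holDegree_of_mem hx
  rw [holDegree_apply, Finset.sum_congr rfl fun l _ => h2 l, Finset.sum_const, Finset.card_univ,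
    Fintype.card_fin, ← Nat.cast_smul_eq_nsmul ℂ, ← sub_eq_zero, ← sub_smul] at h4
  refine (smul_eq_zero.1 h4).resolve_left ?_
  rw [sub_eq_zero]
  exact_mod_cast hp.ne'

theorem eq_zero_of_mul_antihol {p q : ℕ} (hq : q < n) {x : Form n} (hx : x ∈ bidegree n p q)
    (h : ∀ v, x * antihol n v = 0) : x = 0 := by
  apply conjForm_injective
  rw [map_zero]
  refine eq_zero_of_mul_hol hq (conjForm_mem_bidegree hx) (Pi.basisFun ℂ (Fin n)) fun l => ?_
  have h1 := congrArg (conjForm n) (h fun j => conj (Pi.basisFun ℂ (Fin n) l j))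
  rw [map_mul, conjForm_antihol, map_zero] at h1
  simpa using h1

/-- The wedge pairing of `V^{p,q}` with the complementary bidegree is nondegenerate. -/
theorem eq_zero_of_forall_mul_eq_zero {p q r s : ℕ} (hp : p + r = n) (hq : q + s = n)
    {x : Form n} (hx : x ∈ bidegree n p q) (h : ∀ y ∈ bidegree n r s, x * y = 0) : x = 0 := by
  induction r generalizing x p with
  | zero =>
    induction s generalizing x q with
    | zero =>
      rw [← mul_one x]
      exact h 1 one_mem_bidegree
    | succ s ih =>
      refine eq_zero_of_mul_antihol (by omega) hx fun v => ?_
      have hx' : x * antihol n v ∈ bidegree n p (q + 1) :=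
        mul_mem_bidegree' hx (antihol_mem v) (by omega) (by omega)
      refine ih (by omega) hx' fun y hy => ?_
      rw [mul_assoc]
      exact h _ (mul_mem_bidegree' (antihol_mem v) hy (by omega) (by omega))
  | succ r ih =>
    refine eq_zero_of_mul_hol (by omega) hx (Pi.basisFun ℂ (Fin n)) fun l => ?_
    have hx' : x * hol n (Pi.basisFun ℂ (Fin n) l) ∈ bidegree n (p + 1) q :=
      mul_mem_bidegree' hx (hol_mem _) (by omega) (by omega)
    refine ih (by omega) hx' fun y hy => ?_
    rw [mul_assoc]
    exact h _ (mul_mem_bidegree' (hol_mem _) hy (by omega) (by omega))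

/-! ### Dimensions and top degree forms -/

instance : FiniteDimensional ℂ (Form n) :=
  Module.Finite.of_basis (Module.Basis.ExteriorAlgebra (covecBasis n))

theorem bidegree_zero_right (k : ℕ) :
    bidegree n k 0 = (⋀[ℂ]^k (Fin n → ℂ)).map
      (ExteriorAlgebra.map (LinearMap.inl ℂ (Fin n → ℂ) (Fin n → ℂ))).toLinearMap := by
  unfold ExteriorAlgebra.exteriorPower bidegree
  rw [pow_zero, mul_one, Submodule.map_pow]
  congr 1
  rw [← LinearMap.range_comp, ExteriorAlgebra.map_comp_ι]
  rfl

theorem finrank_bidegree_zero_right (k : ℕ) :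
    Module.finrank ℂ (bidegree n k 0) = n.choose k := by
  have h : Function.Injective
      (ExteriorAlgebra.map (LinearMap.inl ℂ (Fin n → ℂ) (Fin n → ℂ))).toLinearMap :=
    ExteriorAlgebra.map_injective ⟨LinearMap.fst ℂ _ _, LinearMap.fst_comp_inl _ _ _⟩
  rw [bidegree_zero_right, ← (Submodule.equivMapOfInjective _ h _).finrank_eq,
    exteriorPower.finrank_eq, Module.finrank_fin_fun]

theorem eq_zero_of_mem_bidegree_of_lt {p q : ℕ} (hp : n < p) {x : Form n}
    (hx : x ∈ bidegree n p q) : x = 0 := by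
  have h : bidegree n p 0 = ⊥ := by
    rw [← Submodule.finrank_eq_zero (R := ℂ), finrank_bidegree_zero_right,
      Nat.choose_eq_zero_of_lt hp]
  have h1 : bidegree n p q = bidegree n p 0 * bidegree n 0 q := by
    rw [bidegree_mul, add_zero, zero_add]
  rwa [h1, h, Submodule.bot_mul, Submodule.mem_bot] at hx

theorem vol_mem : vol n ∈ bidegree n n n := by
  have h : ∀ (m : ℕ) (f : Fin m → Form n), (∀ l, f l ∈ bidegree n 1 1) →
      (List.ofFn f).prod ∈ bidegree n m m := by
    intro m
    induction m with
    | zero =>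
      intro f _
      rw [List.ofFn_zero]
      exact one_mem_bidegree
    | succ m ih =>
      intro f hf
      rw [List.ofFn_succ, List.prod_cons]
      exact mul_mem_bidegree' (hf 0) (ih _ fun l => hf l.succ) (by omega) (by omega)
  refine h n _ fun l => Submodule.smul_mem _ _ ?_
  exact mul_mem_bidegree' (hol_mem _) (antihol_mem _) (by omega) (by omega)

theorem vol_ne_zero : vol n ≠ 0 := by
  intro h
  have := starTop_vol n
  simp [h] at this

theorem eq_starTop_smul_vol {x : Form n} (hx : x ∈ bidegree n n n) : x = starTop n x • vol n := by
  have h1 : Module.finrank ℂ (⋀[ℂ]^(n + n) (Covec n)) = 1 := by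
    rw [exteriorPower.finrank_eq, Module.finrank_prod, Module.finrank_fin_fun, Nat.choose_self]
  have hv : (⟨vol n, bidegree_le_exteriorPower _ _ vol_mem⟩ : ⋀[ℂ]^(n + n) (Covec n)) ≠ 0 := by
    intro h
    exact vol_ne_zero (congrArg Subtype.val h)
  obtain ⟨c, hc⟩ := (finrank_eq_one_iff_of_nonzero' _ hv).1 h1
    ⟨x, bidegree_le_exteriorPower _ _ hx⟩
  have hc' : c • vol n = x := congrArg Subtype.val hc
  rw [← hc', map_smul, starTop_vol, smul_eq_mul, mul_one]

theorem conjForm_dz (l : Fin n) : conjForm n (dz l) = dzbar l := by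
  rw [dz, dzbar, conjForm_hol]
  congr 1
  ext j
  by_cases hj : j = l
  · subst hj
    simp
  · simp [hj]

theorem conjForm_areaForm (l : Fin n) : conjForm n (areaForm l) = areaForm l := by
  have h : dzbar l * dz l = -(dz l * dzbar l) := antihol_mul_hol _ _
  rw [areaForm, conjForm_smul, map_mul, conjForm_dz, ← conjForm_dz, conjForm_conjForm, conjForm_dz,
    h, smul_neg, ← neg_smul]
  congr 1
  simp [neg_div, Complex.conj_ofNat]

theorem conjForm_vol : conjForm n (vol n) = vol n := by
  rw [vol, map_list_prod, List.map_ofFn]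
  congr 2
  funext l
  exact conjForm_areaForm l

theorem starTop_conjForm {x : Form n} (hx : x ∈ bidegree n n n) :
    starTop n (conjForm n x) = conj (starTop n x) := by
  conv_lhs => rw [eq_starTop_smul_vol hx, conjForm_smul, conjForm_vol, map_smul, starTop_vol]
  simp

theorem eq_zero_of_forall_starTop {p q r s : ℕ} (hp : p + r = n) (hq : q + s = n)
    {x : Form n} (hx : x ∈ bidegree n p q) (h : ∀ y ∈ bidegree n r s, starTop n (x * y) = 0) :
    x = 0 := by
  refine eq_zero_of_forall_mul_eq_zero hp hq hx fun y hy => ?_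
  rw [eq_starTop_smul_vol (mul_mem_bidegree' hx hy hp hq), h y hy, zero_smul]

theorem finrank_bidegree_conj (p q : ℕ) :
    Module.finrank ℂ (bidegree n p q) = Module.finrank ℂ (bidegree n q p) := by
  let e : bidegree n p q ≃+ bidegree n q p :=
    { toFun := fun x => ⟨conjForm n x, conjForm_mem_bidegree x.2⟩
      invFun := fun x => ⟨conjForm n x, conjForm_mem_bidegree x.2⟩
      left_inv := fun x => Subtype.ext (conjForm_conjForm _)
      right_inv := fun x => Subtype.ext (conjForm_conjForm _)
      map_add' := fun x y => Subtype.ext (map_add (conjForm n) _ _) }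
  have h := rank_eq_of_equiv_equiv (starRingEnd ℂ) e (starRingAut (R := ℂ)).bijective
    fun c x => Subtype.ext (conjForm_smul c _)
  rw [Module.finrank, h, Module.finrank]

/-- The dimension count of Poincaré duality. -/
theorem finrank_bidegree_le_dual {p q r s : ℕ} (hp : p + r = n) (hq : q + s = n) :
    Module.finrank ℂ (bidegree n p q) ≤ Module.finrank ℂ (bidegree n r s) := by
  let f : bidegree n p q →ₗ[ℂ] Module.Dual ℂ (bidegree n r s) :=
    (((LinearMap.mul ℂ (Form n)).compr₂ (starTop n)).domRestrict₁₂ _ _)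
  have hf : Function.Injective f := by
    rw [← LinearMap.ker_eq_bot, LinearMap.ker_eq_bot']
    intro x hx
    apply Subtype.ext
    refine eq_zero_of_forall_starTop hp hq x.2 fun y hy => ?_
    exact congrArg (fun g => g ⟨y, hy⟩) hx
  exact (LinearMap.finrank_le_finrank_of_injective hf).trans_eq Subspace.dual_finrank_eq

/-- A `(k,k)` form that kills no nonzero element of `V^{p,q}` is Lefschetz: both sides have the
same dimension by Poincaré duality and conjugation. -/
theorem isLefschetz_of_injective {p q k : ℕ} (h : p + q + k = n) {Ω : Form n}
    (hΩ : Ω ∈ bidegree n k k) (hinj : ∀ α ∈ bidegree n p q, α * Ω = 0 → α = 0) :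
    IsLefschetz Ω p q := by
  have hk : n - p - q = k := by omega
  refine ⟨by omega, by rwa [hk], ?_⟩
  have hmaps : ∀ α ∈ bidegree n p q, α * Ω ∈ bidegree n (n - q) (n - p) := fun α hα =>
    mul_mem_bidegree' hα hΩ (by omega) (by omega)
  let f : bidegree n p q →ₗ[ℂ] bidegree n (n - q) (n - p) :=
    (LinearMap.mulRight ℂ Ω).restrict hmaps
  have hf : Function.Injective f := by
    rw [← LinearMap.ker_eq_bot, LinearMap.ker_eq_bot']
    intro x hx
    exact Subtype.ext (hinj x x.2 (congrArg Subtype.val hx))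
  have hle : Module.finrank ℂ (bidegree n (n - q) (n - p)) ≤ Module.finrank ℂ (bidegree n p q) := by
    rw [finrank_bidegree_conj p q]
    exact finrank_bidegree_le_dual (by omega) (by omega)
  have hs : Function.Surjective f :=
    (LinearMap.injective_iff_surjective_of_finrank_eq_finrank
      (le_antisymm (LinearMap.finrank_le_finrank_of_injective hf) hle)).1 hf
  refine ⟨hmaps, ?_, ?_⟩
  · intro x hx y hy hxy
    exact congrArg Subtype.val (@hf ⟨x, hx⟩ ⟨y, hy⟩ (Subtype.ext hxy))
  · intro y hy
    obtain ⟨x, hx⟩ := hs ⟨y, hy⟩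
    exact ⟨x, x.2, congrArg Subtype.val hx⟩

theorem IsLefschetz.eq_zero {p q : ℕ} {Ω : Form n} (h : IsLefschetz Ω p q) {α : Form n}
    (hα : α ∈ bidegree n p q) (h0 : α * Ω = 0) : α = 0 :=
  h.2.2.injOn hα (zero_mem (bidegree n p q)) (by simpa using h0)

/-! ### Holomorphic top forms -/

/-- The holomorphic volume form `dz_1 ∧ ⋯ ∧ dz_n`. -/
noncomputable def holVol (n : ℕ) : Form n := (List.ofFn fun l : Fin n => dz l).prod

theorem prod_hol_mem {m : ℕ} (a : Fin m → Fin n → ℂ) :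
    (List.ofFn fun l => hol n (a l)).prod ∈ bidegree n m 0 := by
  induction m with
  | zero =>
    rw [List.ofFn_zero]
    exact one_mem_bidegree
  | succ m ih =>
    rw [List.ofFn_succ, List.prod_cons]
    exact mul_mem_bidegree' (hol_mem _) (ih _) (by omega) (by omega)

theorem holVol_mem : holVol n ∈ bidegree n n 0 := prod_hol_mem _

/-- Moving all `(1,0)` factors to the front costs `m (m - 1) / 2` transpositions. -/
theorem prod_hol_mul_antihol {m : ℕ} (a b : Fin m → Fin n → ℂ) :
    (List.ofFn fun l => hol n (a l) * antihol n (b l)).prod =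
      (-1 : ℂ) ^ (m * (m - 1) / 2) •
        ((List.ofFn fun l => hol n (a l)).prod * (List.ofFn fun l => antihol n (b l)).prod) := by
  induction m with
  | zero => simp
  | succ m ih =>
    have hs : (m + 1) * (m + 1 - 1) / 2 = m * (m - 1) / 2 + m := by
      rcases m with _ | m
      · rfl
      · simp only [Nat.add_sub_cancel]
        rw [show (m + 1 + 1) * (m + 1) = (m + 1) * m + (m + 1) * 2 by ring,
          Nat.add_mul_div_right _ _ two_pos]
    simp only [List.ofFn_succ, List.prod_cons]
    rw [ih, hs, pow_add, mul_smul_comm, mul_assoc, ← mul_assoc (antihol n (b 0)),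
      bidegree_mul_comm (antihol_mem (b 0)) (prod_hol_mem fun l => a l.succ)]
    simp only [smul_mul_assoc, mul_smul_comm, smul_smul, mul_assoc, zero_add, one_mul, add_zero]

/-- The top degree coefficient of `Z ∧ Z̄` for `Z = dz_1 ∧ ⋯ ∧ dz_n`. -/
noncomputable def holVolNorm (n : ℕ) : ℂ := (-1) ^ (n * (n - 1) / 2) * (-2 * Complex.I) ^ n

theorem holVolNorm_ne_zero : holVolNorm n ≠ 0 := by
  simp [holVolNorm]

theorem starTop_holVol : starTop n (holVol n * conjForm n (holVol n)) = holVolNorm n := by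
  have h1 : conjForm n (holVol n) = (List.ofFn fun l : Fin n => dzbar l).prod := by
    rw [holVol, map_list_prod, List.map_ofFn]
    congr 2
    funext l
    exact conjForm_dz l
  have h2 : vol n = ((Complex.I / 2) ^ n * (-1 : ℂ) ^ (n * (n - 1) / 2)) •
      (holVol n * conjForm n (holVol n)) := by
    rw [h1, vol]
    unfold areaForm
    rw [prod_ofFn_smul]
    simp only [dz, dzbar]
    rw [prod_hol_mul_antihol, smul_smul]
    rfl
  have h3 := starTop_vol n
  rw [h2, map_smul, smul_eq_mul] at h3
  have h4 : holVolNorm n * ((Complex.I / 2) ^ n * (-1 : ℂ) ^ (n * (n - 1) / 2)) = 1 := by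
    rw [holVolNorm, show ∀ a b c : ℂ, a * b * (c * a) = (a * a) * (c * b) by intros; ring,
      ← mul_pow, ← mul_pow]
    have h : Complex.I / 2 * (-2 * Complex.I) = 1 := by
      linear_combination -Complex.I_mul_I
    rw [h]
    simp
  rw [← mul_one (starTop n _), ← h4]
  linear_combination holVolNorm n * h3

/-- The coefficient of an `(n,0)` form with respect to `Z = dz_1 ∧ ⋯ ∧ dz_n`, extended linearly to
all forms as the normalized top degree coefficient of the product with `Z̄`. -/
noncomputable def holCoeff (n : ℕ) : Form n →ₗ[ℂ] ℂ :=
  (holVolNorm n)⁻¹ • (starTop n).comp (LinearMap.mulRight ℂ (conjForm n (holVol n)))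

theorem holVol_ne_zero : holVol n ≠ 0 := by
  intro h
  have := starTop_holVol (n := n)
  rw [h, zero_mul, map_zero] at this
  exact holVolNorm_ne_zero this.symm

theorem eq_holCoeff_smul {x : Form n} (hx : x ∈ bidegree n n 0) :
    x = holCoeff n x • holVol n := by
  have h1 : Module.finrank ℂ (bidegree n n 0) = 1 := by
    rw [finrank_bidegree_zero_right, Nat.choose_self]
  have hv : (⟨holVol n, holVol_mem⟩ : bidegree n n 0) ≠ 0 := by
    intro h
    exact holVol_ne_zero (congrArg Subtype.val h)
  obtain ⟨c, hc⟩ := (finrank_eq_one_iff_of_nonzero' _ hv).1 h1 ⟨x, hx⟩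
  have hc' : c • holVol n = x := congrArg Subtype.val hc
  rw [← hc', map_smul]
  congr 1
  simp only [holCoeff, LinearMap.smul_apply, LinearMap.comp_apply, LinearMap.mulRight_apply,
    starTop_holVol, smul_eq_mul]
  rw [inv_mul_cancel₀ holVolNorm_ne_zero, mul_one]

theorem starTop_mul_conjForm {x y : Form n} (hx : x ∈ bidegree n n 0) (hy : y ∈ bidegree n n 0) :
    starTop n (x * conjForm n y) = holVolNorm n * (holCoeff n x * conj (holCoeff n y)) := by
  conv_lhs => rw [eq_holCoeff_smul hx, eq_holCoeff_smul hy]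
  rw [conjForm_smul, smul_mul_smul_comm, map_smul, starTop_holVol, smul_eq_mul]
  ring

/-! ### Mixed discriminants of positive definite `2 × 2` matrices -/

/-- A positive definite Hermitian matrix `[[a, u], [ū, d]]`. -/
structure PosHerm where
  a : ℝ
  d : ℝ
  u : ℂ
  a_pos : 0 < a
  d_pos : 0 < d
  normSq_lt : Complex.normSq u < a * d

/-- The polarization of `2 det`, i.e. twice the mixed discriminant. -/
noncomputable def PosHerm.mixed (B C : PosHerm) : ℝ :=
  B.a * C.d + C.a * B.d - 2 * (B.u * conj C.u).re

theorem PosHerm.mixed_comm (B C : PosHerm) : B.mixed C = C.mixed B := by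
  simp [mixed]
  ring

theorem PosHerm.mixed_pos (B C : PosHerm) : 0 < B.mixed C := by
  have h1 : (B.u * conj C.u).re ^ 2 ≤ Complex.normSq B.u * Complex.normSq C.u := by
    rw [← Complex.normSq_conj C.u, ← Complex.normSq_mul, Complex.normSq_apply]
    nlinarith [sq_nonneg (B.u * conj C.u).im]
  have h2 : Complex.normSq B.u * Complex.normSq C.u < (B.a * B.d) * (C.a * C.d) :=
    mul_lt_mul'' B.normSq_lt C.normSq_lt (Complex.normSq_nonneg _) (Complex.normSq_nonneg _)
  have h3 : (B.u * conj C.u).re ^ 2 < ((B.a * C.d + C.a * B.d) / 2) ^ 2 := by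
    nlinarith [sq_nonneg (B.a * C.d - C.a * B.d)]
  have h4 : 0 < (B.a * C.d + C.a * B.d) / 2 := by
    have := mul_pos B.a_pos C.d_pos
    have := mul_pos C.a_pos B.d_pos
    linarith
  have h5 := abs_lt_of_sq_lt_sq h3 h4.le
  have h6 := (abs_lt.1 h5).2
  unfold mixed
  linarith

/-- The form `∑ 2D(B_i, B_j) g_i ḡ_j` is `|tr X|² - ‖X‖²` with `X = ∑ g_i B_i` and the
Hilbert-Schmidt norm, so it is nonpositive if `X` has trace zero. -/
theorem PosHerm.sum_mixed_le {ι : Type*} [Fintype ι] (B : ι → PosHerm) (g : ι → ℂ)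
    (h : ∑ i, ((B i).a + (B i).d : ℂ) * g i = 0) :
    ∑ i, ∑ j, (B i).mixed (B j) * (g i * conj (g j)).re ≤ 0 := by
  -- The subtracted squares are those of the entries of `∑ g_i B_i`.
  have key : ((∑ i, ∑ j, (B i).mixed (B j) * (g i * conj (g j)).re : ℝ) : ℂ) =
      (∑ i, ((B i).a + (B i).d : ℂ) * g i) * conj (∑ i, ((B i).a + (B i).d : ℂ) * g i)
      - (∑ i, (B i).a * g i) * conj (∑ i, (B i).a * g i)
      - (∑ i, (B i).d * g i) * conj (∑ i, (B i).d * g i)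
      - (∑ i, (B i).u * g i) * conj (∑ i, (B i).u * g i)
      - (∑ i, conj (B i).u * g i) * conj (∑ i, conj (B i).u * g i) := by
    have h2 : (∑ i, ∑ j, (B i).mixed (B j) * (g i * conj (g j)).re : ℝ) =
        (∑ i, ∑ j, ((B i).mixed (B j) : ℂ) * (g i * conj (g j))) := by
      have h3 : ∑ i, ∑ j, ((B i).mixed (B j) : ℂ) * (g i * conj (g j)) =
          ∑ i, ∑ j, ((B i).mixed (B j) : ℂ) * (g j * conj (g i)) := by
        rw [Finset.sum_comm]
        simp only [PosHerm.mixed_comm]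
      have h4 : ∀ z : ℂ, (z.re : ℂ) = (z + conj z) / 2 := fun z => by
        rw [Complex.add_conj]
        push_cast
        ring
      push_cast
      simp only [h4]
      rw [← mul_right_inj' (two_ne_zero (α := ℂ)), two_mul (∑ i, ∑ j, _ * (g i * _))]
      conv_rhs => rw [h3]
      conv_rhs => enter [1]; rw [← h3]
      simp only [Finset.mul_sum, ← Finset.sum_add_distrib]
      refine Finset.sum_congr rfl fun i _ => Finset.sum_congr rfl fun j _ => ?_
      simp only [map_mul, Complex.conj_conj]
      ring
    rw [h2]
    simp only [map_sum, Finset.sum_mul_sum, ← Finset.sum_sub_distrib]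
    refine Finset.sum_congr rfl fun i _ => Finset.sum_congr rfl fun j _ => ?_
    have h5 : (((B i).mixed (B j) : ℝ) : ℂ) = (B i).a * (B j).d + (B j).a * (B i).d
        - (B i).u * conj (B j).u - conj (B i).u * (B j).u := by
      unfold PosHerm.mixed
      have h6 := Complex.add_conj ((B i).u * conj (B j).u)
      rw [map_mul, Complex.conj_conj] at h6
      push_cast at h6 ⊢
      linear_combination h6
    rw [h5]
    simp only [map_mul, map_add, Complex.conj_ofReal, Complex.conj_conj]
    ring
  rw [h] at key
  simp only [Complex.mul_conj, Complex.normSq_zero] at key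
  have key2 : ∑ i, ∑ j, (B i).mixed (B j) * (g i * conj (g j)).re =
      0 - Complex.normSq (∑ i, (B i).a * g i) - Complex.normSq (∑ i, (B i).d * g i)
      - Complex.normSq (∑ i, (B i).u * g i) - Complex.normSq (∑ i, conj (B i).u * g i) := by
    exact_mod_cast key
  rw [key2]
  have := Complex.normSq_nonneg (∑ i, (B i).a * g i)
  have := Complex.normSq_nonneg (∑ i, (B i).d * g i)
  have := Complex.normSq_nonneg (∑ i, (B i).u * g i)
  have := Complex.normSq_nonneg (∑ i, conj (B i).u * g i)
  linarith

/-- The complementary form: `∑_{i<j} 2 D(B_k, B_l) Re (f_i f̄_j)` with `{k,l}` the complement of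
`{i,j}` in `{0,1,2,3}`. -/
noncomputable def complForm (B : Fin 4 → PosHerm) (f : Fin 4 → ℂ) : ℝ :=
  (B 2).mixed (B 3) * (f 0 * conj (f 1)).re + (B 1).mixed (B 3) * (f 0 * conj (f 2)).re +
  (B 1).mixed (B 2) * (f 0 * conj (f 3)).re + (B 0).mixed (B 3) * (f 1 * conj (f 2)).re +
  (B 0).mixed (B 2) * (f 1 * conj (f 3)).re + (B 0).mixed (B 1) * (f 2 * conj (f 3)).re

theorem sqrt_mul_sqrt_mul {x y c d : ℝ} (hx : 0 ≤ x) (hc : 0 < c) (hd : 0 < d)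
    (h : x * y = (d / c) ^ 2) : √x * √y * c = d := by
  rw [← Real.sqrt_mul hx, h, Real.sqrt_sq (div_pos hd hc).le]
  field_simp

/-- The complementary form is negative definite on some hyperplane. The diagonal change of
variables `g_i = e_i f_i` with `e_i e_j D(B_i, B_j) = D(B_k, B_l)` turns it into
`∑_{i<j} 2 D(B_i, B_j) Re (g_i ḡ_j)`. -/
theorem exists_complForm_neg (B : Fin 4 → PosHerm) :
    ∃ t : Fin 4 → ℂ, ∀ f : Fin 4 → ℂ, ∑ i, t i * f i = 0 →
      complForm B f ≤ 0 ∧ (complForm B f = 0 → f = 0) := by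
  have hp := fun i j => (B i).mixed_pos (B j)
  set c := fun i j => (B i).mixed (B j) with hc
  have h01 := hp 0 1
  have h02 := hp 0 2
  have h03 := hp 0 3
  have h12 := hp 1 2
  have h13 := hp 1 3
  have h23 := hp 2 3
  obtain ⟨e, he, k01, k02, k03, k12, k13, k23⟩ : ∃ e : Fin 4 → ℝ, (∀ i, 0 < e i) ∧
      e 0 * e 1 * c 0 1 = c 2 3 ∧ e 0 * e 2 * c 0 2 = c 1 3 ∧ e 0 * e 3 * c 0 3 = c 1 2 ∧
      e 1 * e 2 * c 1 2 = c 0 3 ∧ e 1 * e 3 * c 1 3 = c 0 2 ∧ e 2 * e 3 * c 2 3 = c 0 1 := by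
    -- Solving the six equations: `e_i²` is the product of the `c` with indices different from `i`,
    -- divided by the product of the `c` with an index `i`.
    refine ⟨![√(c 1 2 * c 1 3 * c 2 3 / (c 0 1 * c 0 2 * c 0 3)),
      √(c 0 2 * c 0 3 * c 2 3 / (c 0 1 * c 1 2 * c 1 3)),
      √(c 0 1 * c 0 3 * c 1 3 / (c 0 2 * c 1 2 * c 2 3)),
      √(c 0 1 * c 0 2 * c 1 2 / (c 0 3 * c 1 3 * c 2 3))], ?_, ?_, ?_, ?_, ?_, ?_, ?_⟩
    · intro i
      fin_cases i <;> simp only [hc] <;> simp <;> positivity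
    all_goals
      refine sqrt_mul_sqrt_mul ?_ ?_ ?_ ?_
      · simp only [hc]
        positivity
      · assumption
      · assumption
      · simp only [hc]
        field_simp
  -- The hyperplane on which `∑ g_i B_i` has trace zero.
  refine ⟨fun i => ((B i).a + (B i).d) * e i, fun f hf => ?_⟩
  have h1 := PosHerm.sum_mixed_le B (fun i => e i * f i) (by
    rw [← hf]
    refine Finset.sum_congr rfl fun i _ => ?_
    ring)
  have hsymm : ∀ i j, (B i).mixed (B j) = (B j).mixed (B i) := fun i j => (B i).mixed_comm (B j)
  have hre : ∀ i j, ((e i * f i : ℂ) * conj (e j * f j : ℂ)).re =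
      e i * e j * (f i * conj (f j)).re := by
    intro i j
    rw [map_mul, Complex.conj_ofReal, ← Complex.re_ofReal_mul]
    push_cast
    congr 1
    ring
  have hre' : ∀ i j, (f i * conj (f j)).re = (f j * conj (f i)).re := by
    intro i j
    rw [← Complex.conj_re, map_mul, Complex.conj_conj, mul_comm]
  have h2 : 2 * complForm B f + ∑ i, (B i).mixed (B i) * e i ^ 2 * Complex.normSq (f i) ≤ 0 := by
    refine le_trans (le_of_eq ?_) h1
    simp only [hre, Fin.sum_univ_four]
    rw [complForm, hsymm 1 0, hsymm 2 0, hsymm 3 0, hsymm 2 1, hsymm 3 1, hsymm 3 2,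
      hre' 1 0, hre' 2 0, hre' 3 0, hre' 2 1, hre' 3 1, hre' 3 2]
    simp only [Complex.mul_conj, Complex.ofReal_re]
    simp only [hc] at k01 k02 k03 k12 k13 k23
    linear_combination (-2) * (f 0 * conj (f 1)).re * k01 - 2 * (f 0 * conj (f 2)).re * k02
      - 2 * (f 0 * conj (f 3)).re * k03 - 2 * (f 1 * conj (f 2)).re * k12
      - 2 * (f 1 * conj (f 3)).re * k13 - 2 * (f 2 * conj (f 3)).re * k23
  have h3 : ∀ i, 0 ≤ (B i).mixed (B i) * e i ^ 2 * Complex.normSq (f i) := fun i =>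
    mul_nonneg (mul_nonneg (hp i i).le (sq_nonneg _)) (Complex.normSq_nonneg _)
  have h4 := Finset.sum_nonneg fun i (_ : i ∈ Finset.univ) => h3 i
  refine ⟨by linarith, fun h0 => ?_⟩
  have h5 : ∑ i, (B i).mixed (B i) * e i ^ 2 * Complex.normSq (f i) = 0 := by linarith
  funext i
  have h6 := (Finset.sum_eq_zero_iff_of_nonneg fun i _ => h3 i).1 h5 i (Finset.mem_univ i)
  have h7 : (B i).mixed (B i) * e i ^ 2 ≠ 0 := (mul_pos (hp i i) (pow_pos (he i) 2)).ne'
  exact Complex.normSq_eq_zero.1 ((mul_eq_zero.1 h6).resolve_left h7)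

/-! ### Symmetrization over quadruples of indices -/

theorem sum_perm_four (F : Fin 4 → Fin 4 → Fin 4 → Fin 4 → ℝ) :
    ∑ σ : Equiv.Perm (Fin 4), F (σ 0) (σ 1) (σ 2) (σ 3) =
      F 0 1 2 3 + F 0 1 3 2 + F 0 2 1 3 + F 0 2 3 1 + F 0 3 1 2 + F 0 3 2 1 +
      F 1 0 2 3 + F 1 0 3 2 + F 1 2 0 3 + F 1 2 3 0 + F 1 3 0 2 + F 1 3 2 0 +
      F 2 0 1 3 + F 2 0 3 1 + F 2 1 0 3 + F 2 1 3 0 + F 2 3 0 1 + F 2 3 1 0 +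
      F 3 0 1 2 + F 3 0 2 1 + F 3 1 0 2 + F 3 1 2 0 + F 3 2 0 1 + F 3 2 1 0 := by
  have h : (Finset.univ : Finset (Equiv.Perm (Fin 4))).image (fun σ => (σ 0, σ 1, σ 2, σ 3)) =
      {(0, 1, 2, 3), (0, 1, 3, 2), (0, 2, 1, 3), (0, 2, 3, 1), (0, 3, 1, 2), (0, 3, 2, 1),
        (1, 0, 2, 3), (1, 0, 3, 2), (1, 2, 0, 3), (1, 2, 3, 0), (1, 3, 0, 2), (1, 3, 2, 0),
        (2, 0, 1, 3), (2, 0, 3, 1), (2, 1, 0, 3), (2, 1, 3, 0), (2, 3, 0, 1), (2, 3, 1, 0),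
        (3, 0, 1, 2), (3, 0, 2, 1), (3, 1, 0, 2), (3, 1, 2, 0), (3, 2, 0, 1), (3, 2, 1, 0)} := by
    decide
  have hinj : Function.Injective fun σ : Equiv.Perm (Fin 4) => (σ 0, σ 1, σ 2, σ 3) := by
    intro σ τ hστ
    simp only [Prod.mk.injEq] at hστ
    ext i
    fin_cases i <;> simp [hστ]
  rw [← Finset.sum_image (f := fun p : Fin 4 × Fin 4 × Fin 4 × Fin 4 =>
    F p.1 p.2.1 p.2.2.1 p.2.2.2) (fun σ _ τ _ h => hinj h), h]
  repeat rw [Finset.sum_insert (by decide)]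
  rw [Finset.sum_singleton]
  ring

/-- A family of coefficients `h_j(k,l,m)`, alternating in `(k,l,m)`. -/
structure IsAltCoeff (h : Fin n → Fin n → Fin n → Fin n → ℂ) : Prop where
  swap_left : ∀ j k l m, h j l k m = -h j k l m
  swap_right : ∀ j k l m, h j k m l = -h j k l m

/-- The four coefficients supported on the indices `s_0, …, s_3`, with the signs that come from
moving the distinguished index to the front. -/
def blockCoeff (h : Fin n → Fin n → Fin n → Fin n → ℂ) (s : Fin 4 → Fin n) : Fin 4 → ℂ :=
  ![h (s 0) (s 1) (s 2) (s 3), -h (s 1) (s 0) (s 2) (s 3), h (s 2) (s 0) (s 1) (s 3),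
    -h (s 3) (s 0) (s 1) (s 2)]

/-- The summands `c_{kl} Re (h_j(j',k,l) h̄_{j'}(j,k,l))` of the Hodge form on `V^{n-3,1}`, for
`s = (j,j',k,l)`. -/
noncomputable def pairTerm (B : Fin n → PosHerm) (h : Fin n → Fin n → Fin n → Fin n → ℂ)
    (s : Fin 4 → Fin n) : ℝ :=
  (B (s 2)).mixed (B (s 3)) *
    (h (s 0) (s 1) (s 2) (s 3) * conj (h (s 1) (s 0) (s 2) (s 3))).re

theorem sum_eq_sum_perm (g : (Fin 4 → Fin n) → ℝ) :
    24 * ∑ s, g s = ∑ s, ∑ σ : Equiv.Perm (Fin 4), g (s ∘ σ) := by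
  rw [Finset.sum_comm]
  have h : ∀ σ : Equiv.Perm (Fin 4), ∑ s : Fin 4 → Fin n, g (s ∘ σ) = ∑ s, g s := fun σ =>
    Fintype.sum_equiv (Equiv.arrowCongr σ.symm (Equiv.refl _)) _ _ fun s => rfl
  rw [Finset.sum_congr rfl fun σ _ => h σ, Finset.sum_const, Finset.card_univ,
    Fintype.card_perm, Fintype.card_fin, nsmul_eq_mul]
  norm_num [Nat.factorial]

section

variable {h : Fin n → Fin n → Fin n → Fin n → ℂ}

theorem IsAltCoeff.rotate (hh : IsAltCoeff h) (j k l m : Fin n) : h j l m k = h j k l m := by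
  rw [hh.swap_right, hh.swap_left, neg_neg]

theorem IsAltCoeff.rotate' (hh : IsAltCoeff h) (j k l m : Fin n) : h j m k l = h j k l m := by
  rw [hh.swap_left, hh.swap_right, neg_neg]

theorem IsAltCoeff.swap_outer (hh : IsAltCoeff h) (j k l m : Fin n) :
    h j m l k = -h j k l m := by
  rw [hh.swap_left, hh.rotate]

/-- On four indices the pair terms add up to a negative multiple of the complementary form: bringing
`j` and `j'` to the front differs by a transposition. -/
theorem sum_perm_pairTerm (hh : IsAltCoeff h) (B : Fin n → PosHerm) (s : Fin 4 → Fin n) :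
    ∑ σ : Equiv.Perm (Fin 4), pairTerm B h (s ∘ σ) =
      -4 * complForm (B ∘ s) (blockCoeff h s) := by
  have hre : ∀ x y : ℂ, (x * conj y).re = (y * conj x).re := by
    intro x y
    rw [← Complex.conj_re, map_mul, Complex.conj_conj, mul_comm]
  have hm : ∀ i j, (B (s i)).mixed (B (s j)) = (B (s j)).mixed (B (s i)) := fun i j =>
    PosHerm.mixed_comm _ _
  have p132 := fun j k l m => hh.swap_right (s j) (s k) (s l) (s m)
  have p213 := fun j k l m => hh.swap_left (s j) (s k) (s l) (s m)
  have p231 := fun j k l m => hh.rotate (s j) (s k) (s l) (s m)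
  have p312 := fun j k l m => hh.rotate' (s j) (s k) (s l) (s m)
  have p321 := fun j k l m => hh.swap_outer (s j) (s k) (s l) (s m)
  simp only [pairTerm, Function.comp_apply]
  rw [sum_perm_four fun i j k l => (B (s k)).mixed (B (s l)) *
    (h (s i) (s j) (s k) (s l) * conj (h (s j) (s i) (s k) (s l))).re]
  simp only [p132 0 1 2 3, p213 0 1 2 3, p231 0 1 2 3, p312 0 1 2 3, p321 0 1 2 3,
    p132 1 0 2 3, p213 1 0 2 3, p231 1 0 2 3, p312 1 0 2 3, p321 1 0 2 3,
    p132 2 0 1 3, p213 2 0 1 3, p231 2 0 1 3, p312 2 0 1 3, p321 2 0 1 3,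
    p132 3 0 1 2, p213 3 0 1 2, p231 3 0 1 2, p312 3 0 1 2, p321 3 0 1 2,
    hm 1 0, hm 2 0, hm 3 0, hm 2 1, hm 3 1, hm 3 2]
  simp only [complForm, blockCoeff, Function.comp_apply, Matrix.cons_val, map_neg, neg_mul,
    mul_neg, neg_neg, Complex.neg_re]
  rw [hre (h (s 1) (s 0) (s 2) (s 3)) (h (s 0) (s 1) (s 2) (s 3)),
    hre (h (s 2) (s 0) (s 1) (s 3)) (h (s 0) (s 1) (s 2) (s 3)),
    hre (h (s 3) (s 0) (s 1) (s 2)) (h (s 0) (s 1) (s 2) (s 3)),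
    hre (h (s 2) (s 0) (s 1) (s 3)) (h (s 1) (s 0) (s 2) (s 3)),
    hre (h (s 3) (s 0) (s 1) (s 2)) (h (s 1) (s 0) (s 2) (s 3)),
    hre (h (s 3) (s 0) (s 1) (s 2)) (h (s 2) (s 0) (s 1) (s 3))]
  ring

theorem sum_perm_normSq (hh : IsAltCoeff h) (s : Fin 4 → Fin n) :
    ∑ σ : Equiv.Perm (Fin 4),
      Complex.normSq (h (s (σ 0)) (s (σ 1)) (s (σ 2)) (s (σ 3))) =
      6 * ∑ i, Complex.normSq (blockCoeff h s i) := by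
  have p132 := fun j k l m => hh.swap_right (s j) (s k) (s l) (s m)
  have p213 := fun j k l m => hh.swap_left (s j) (s k) (s l) (s m)
  have p231 := fun j k l m => hh.rotate (s j) (s k) (s l) (s m)
  have p312 := fun j k l m => hh.rotate' (s j) (s k) (s l) (s m)
  have p321 := fun j k l m => hh.swap_outer (s j) (s k) (s l) (s m)
  rw [sum_perm_four fun i j k l => Complex.normSq (h (s i) (s j) (s k) (s l))]
  simp only [p132 0 1 2 3, p213 0 1 2 3, p231 0 1 2 3, p312 0 1 2 3, p321 0 1 2 3,
    p132 1 0 2 3, p213 1 0 2 3, p231 1 0 2 3, p312 1 0 2 3, p321 1 0 2 3,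
    p132 2 0 1 3, p213 2 0 1 3, p231 2 0 1 3, p312 2 0 1 3, p321 2 0 1 3,
    p132 3 0 1 2, p213 3 0 1 2, p231 3 0 1 2, p312 3 0 1 2, p321 3 0 1 2,
    Fin.sum_univ_four, blockCoeff, Matrix.cons_val, Complex.normSq_neg]
  ring

theorem IsAltCoeff.eq_zero_of_not_injOn (hh : IsAltCoeff h) (j k l m : Fin n)
    (hs : k = l ∨ k = m ∨ l = m) : h j k l m = 0 := by
  rcases hs with rfl | rfl | rfl
  · exact self_eq_neg.1 (hh.swap_left j k k m)
  · exact self_eq_neg.1 (hh.swap_outer j k l k)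
  · exact self_eq_neg.1 (hh.swap_right j k l l)

theorem pairTerm_eq_zero (hh : IsAltCoeff h) (B : Fin n → PosHerm) (s : Fin 4 → Fin n)
    (hs : ¬Function.Injective s) (h01 : s 0 ≠ s 1) : pairTerm B h s = 0 := by
  have h1 : h (s 0) (s 1) (s 2) (s 3) = 0 ∨ h (s 1) (s 0) (s 2) (s 3) = 0 := by
    by_contra hc
    rw [not_or] at hc
    obtain ⟨hc1, hc2⟩ := hc
    have h12 : s 1 ≠ s 2 := fun e => hc1 (hh.eq_zero_of_not_injOn _ _ _ _ (Or.inl e))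
    have h13 : s 1 ≠ s 3 := fun e => hc1 (hh.eq_zero_of_not_injOn _ _ _ _ (Or.inr (Or.inl e)))
    have h23 : s 2 ≠ s 3 := fun e => hc1 (hh.eq_zero_of_not_injOn _ _ _ _ (Or.inr (Or.inr e)))
    have h02 : s 0 ≠ s 2 := fun e => hc2 (hh.eq_zero_of_not_injOn _ _ _ _ (Or.inl e))
    have h03 : s 0 ≠ s 3 := fun e => hc2 (hh.eq_zero_of_not_injOn _ _ _ _ (Or.inr (Or.inl e)))
    apply hs
    intro i j hij
    fin_cases i <;> fin_cases j <;> first | rfl | exact absurd hij ‹_› | exact absurd hij.symm ‹_›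
  unfold pairTerm
  rcases h1 with h1 | h1 <;> simp [h1]

theorem pairTerm_nonneg (hh : IsAltCoeff h) (B : Fin n → PosHerm) (s : Fin 4 → Fin n)
    (hs : ¬Function.Injective s) : 0 ≤ pairTerm B h s := by
  by_cases h01 : s 0 = s 1
  · unfold pairTerm
    rw [h01, Complex.mul_conj, Complex.ofReal_re]
    exact mul_nonneg (PosHerm.mixed_pos _ _).le (Complex.normSq_nonneg _)
  · exact (pairTerm_eq_zero hh B s hs h01).ge

/-- Every injective quadruple is a permutation of an increasing one. -/
theorem exists_strictMono_comp (s : Fin 4 → Fin n) (hs : Function.Injective s) :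
    ∃ (m : Fin 4 → Fin n) (σ : Equiv.Perm (Fin 4)), StrictMono m ∧ s = m ∘ σ := by
  refine ⟨s ∘ Tuple.sort s, (Tuple.sort s).symm, ?_, ?_⟩
  · exact (Tuple.monotone_sort s).strictMono_of_injective (hs.comp (Tuple.sort s).injective)
  · ext i
    simp

/-- If on every increasing quadruple the complementary form is negative at the four coefficients, or
these vanish, then the sum of all pair terms is positive unless all coefficients vanish. -/
theorem sum_pairTerm_pos (hh : IsAltCoeff h) (B : Fin n → PosHerm)
    (hneg : ∀ m : Fin 4 → Fin n, StrictMono m →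
      complForm (B ∘ m) (blockCoeff h m) ≤ 0 ∧
        (complForm (B ∘ m) (blockCoeff h m) = 0 → blockCoeff h m = 0)) :
    0 ≤ ∑ s, pairTerm B h s ∧ (∑ s, pairTerm B h s = 0 → h = 0) := by
  have hperm : ∀ (m : Fin 4 → Fin n) (σ : Equiv.Perm (Fin 4)),
      ∑ τ : Equiv.Perm (Fin 4), pairTerm B h ((m ∘ σ) ∘ τ) =
        ∑ τ : Equiv.Perm (Fin 4), pairTerm B h (m ∘ τ) := fun m σ =>
    Fintype.sum_equiv (Equiv.mulLeft σ) _ _ fun τ => rfl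
  have hnn : ∀ s : Fin 4 → Fin n,
      0 ≤ ∑ τ : Equiv.Perm (Fin 4), pairTerm B h (s ∘ τ) := by
    intro s
    by_cases hs : Function.Injective s
    · obtain ⟨m, σ, hm, rfl⟩ := exists_strictMono_comp s hs
      rw [hperm, sum_perm_pairTerm hh]
      linarith [(hneg m hm).1]
    · refine Finset.sum_nonneg fun τ _ => pairTerm_nonneg hh B _ fun hi => hs ?_
      have := hi.comp τ.symm.injective
      rwa [Function.comp_assoc, Equiv.self_comp_symm, Function.comp_id] at this
  have hsum := sum_eq_sum_perm fun s => pairTerm B h s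
  refine ⟨by linarith [Finset.sum_nonneg fun s (_ : s ∈ Finset.univ) => hnn s], fun h0 => ?_⟩
  rw [h0, mul_zero] at hsum
  have hz := fun s => (Finset.sum_eq_zero_iff_of_nonneg fun s _ => hnn s).1 hsum.symm s
    (Finset.mem_univ s)
  funext j k l m
  set s : Fin 4 → Fin n := ![j, k, l, m] with hsdef
  change h (s 0) (s 1) (s 2) (s 3) = 0
  by_cases hs : Function.Injective s
  · obtain ⟨m, σ, hm, hsm⟩ := exists_strictMono_comp s hs
    have h1 := hz s
    rw [hsm, hperm, sum_perm_pairTerm hh] at h1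
    have h2 := (hneg m hm).2 (by linarith)
    have h3 := sum_perm_normSq hh m
    simp only [h2, Pi.zero_apply, Complex.normSq_zero, Finset.sum_const_zero, mul_zero] at h3
    have h4 := (Finset.sum_eq_zero_iff_of_nonneg fun τ _ => Complex.normSq_nonneg _).1 h3 σ
      (Finset.mem_univ σ)
    rw [hsm]
    exact Complex.normSq_eq_zero.1 h4
  · by_cases h' : h j k l m = 0
    · exact h'
    · exfalso
      have hkl : k ≠ l := fun e => h' (hh.eq_zero_of_not_injOn _ _ _ _ (Or.inl e))
      have hkm : k ≠ m := fun e => h' (hh.eq_zero_of_not_injOn _ _ _ _ (Or.inr (Or.inl e)))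
      have hlm : l ≠ m := fun e => h' (hh.eq_zero_of_not_injOn _ _ _ _ (Or.inr (Or.inr e)))
      -- The repeated index is the first one; after rotating `(k,l,m)` it is `s 0 = s 1`, and the
      -- pair term is then `|h|²` times a positive number.
      have hdiag : ∀ k l m, h j k l m ≠ 0 → j = k → False := by
        rintro k l m hne rfl
        have hs' : ¬Function.Injective (![j, j, l, m] : Fin 4 → Fin n) := fun hi =>
          absurd (@hi 0 1 rfl) (by decide)
        have h1 := (Finset.sum_eq_zero_iff_of_nonneg fun τ _ =>
          pairTerm_nonneg hh B _ fun hi => ?_).1 (hz ![j, j, l, m]) 1 (Finset.mem_univ _)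
        · simp only [pairTerm, Equiv.Perm.coe_one, Function.comp_id, Matrix.cons_val,
            Complex.mul_conj, Complex.ofReal_re] at h1
          exact hne (Complex.normSq_eq_zero.1
            ((mul_eq_zero.1 h1).resolve_left (PosHerm.mixed_pos _ _).ne'))
        · have := hi.comp τ.symm.injective
          rw [Function.comp_assoc, Equiv.self_comp_symm, Function.comp_id] at this
          exact hs' this
      have hjk : j ≠ k := fun e => hdiag k l m h' e
      have hjl : j ≠ l := fun e => hdiag l m k (by rwa [hh.rotate]) e
      have hjm : j ≠ m := fun e => hdiag m k l (by rwa [hh.rotate']) e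
      apply hs
      intro a b hab
      fin_cases a <;> fin_cases b <;>
        first | rfl | exact absurd hab ‹_› | exact absurd hab.symm ‹_›

end

/-! ### Determinants of diagonalized matrices -/

/-- The `(1,1)` form `(√-1/2) η ∧ η̄` of a covector `η = ∑ v_j dz_j`. -/
noncomputable def lineForm (v : Fin n → ℂ) : Form n :=
  (Complex.I / 2) • (hol n v * conjForm n (hol n v))

/-- The form `½ ∑ 2D(B_k, B_l) W_k ∧ W_l` with `W_l = (√-1/2) w_l ∧ w̄_l`: the determinant of the
matrix `∑ B_l W_l` of `(1,1)` forms. -/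
noncomputable def discForm (w : Fin n → Fin n → ℂ) (B : Fin n → PosHerm) : Form n :=
  (1 / 2 : ℂ) • ∑ k, ∑ l, ((B k).mixed (B l) : ℂ) • (lineForm (w k) * lineForm (w l))

theorem conj_hol_mem (v : Fin n → ℂ) : conjForm n (hol n v) ∈ bidegree n 0 1 :=
  conjForm_mem_bidegree (hol_mem v)

theorem lineForm_mem (v : Fin n → ℂ) : lineForm v ∈ bidegree n 1 1 :=
  Submodule.smul_mem _ _ (mul_mem_bidegree' (hol_mem v) (conj_hol_mem v) (by omega) (by omega))

theorem conjForm_lineForm (v : Fin n → ℂ) : conjForm n (lineForm v) = lineForm v := by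
  rw [lineForm, conjForm_smul, map_mul, conjForm_conjForm, conjForm_hol, antihol_mul_hol,
    smul_neg, ← neg_smul]
  congr 1
  simp [neg_div, Complex.conj_ofNat]

theorem discForm_mem (w : Fin n → Fin n → ℂ) (B : Fin n → PosHerm) :
    discForm w B ∈ bidegree n 2 2 :=
  Submodule.smul_mem _ _ <| Submodule.sum_mem _ fun _ _ => Submodule.sum_mem _ fun _ _ =>
    Submodule.smul_mem _ _ <| mul_mem_bidegree' (lineForm_mem _) (lineForm_mem _) rfl rfl

theorem conjForm_discForm (w : Fin n → Fin n → ℂ) (B : Fin n → PosHerm) :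
    conjForm n (discForm w B) = discForm w B := by
  simp only [discForm, conjForm_smul, map_sum, map_mul, conjForm_lineForm, Complex.conj_ofReal]
  congr 1
  simp [Complex.conj_ofNat]

theorem isKahler_iff {ω : Form n} :
    IsKahler ω ↔ ∃ v : Module.Basis (Fin n) ℂ (Fin n → ℂ), ω = ∑ l, lineForm (v l) :=
  Iff.rfl

theorem IsKahler.mem {ω : Form n} (h : IsKahler ω) : ω ∈ bidegree n 1 1 := by
  obtain ⟨v, rfl⟩ := isKahler_iff.1 h
  exact Submodule.sum_mem _ fun _ _ => lineForm_mem _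

theorem IsKahler.conj_eq {ω : Form n} (h : IsKahler ω) : conjForm n ω = ω := by
  obtain ⟨v, rfl⟩ := isKahler_iff.1 h
  simp only [map_sum, conjForm_lineForm]

/-! ### The top degree coefficients of products of real forms -/

theorem mul_conj_mul_lineForm {r : ℕ} {x y : Form n} (hy : y ∈ bidegree n r 0)
    (v : Fin n → ℂ) : x * conjForm n y * lineForm v =
      (Complex.I / 2 * (-1) ^ r) • (x * hol n v * conjForm n (y * hol n v)) := by
  have h1 : conjForm n y * hol n v = (-1 : ℂ) ^ r • (hol n v * conjForm n y) := by
    have := bidegree_mul_comm (conjForm_mem_bidegree hy) (hol_mem v)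
    simpa using this
  rw [lineForm, mul_smul_comm, mul_assoc x, ← mul_assoc (conjForm n y), h1, map_mul, smul_mul_assoc,
    mul_smul_comm, smul_smul]
  simp only [mul_assoc]

theorem mul_conj_mul_lineForm₂ {r : ℕ} {x y : Form n} (hy : y ∈ bidegree n r 0)
    (u v : Fin n → ℂ) : x * conjForm n y * (lineForm u * lineForm v) =
      (1 / 4 : ℂ) • (x * hol n u * hol n v * conjForm n (y * hol n u * hol n v)) := by
  have hy' : y * hol n u ∈ bidegree n (r + 1) 0 :=
    mul_mem_bidegree' hy (hol_mem u) (by omega) (by omega)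
  rw [← mul_assoc, mul_conj_mul_lineForm hy, smul_mul_assoc, mul_conj_mul_lineForm hy',
    smul_smul]
  congr 1
  have h : ((-1 : ℂ) ^ r) ^ 2 = 1 := by
    rw [← pow_mul, mul_comm, pow_mul]
    simp
  linear_combination (-(Complex.I ^ 2) / 4) * h - (1 / 4) * Complex.I_sq

theorem mul_hol_hol_mem {p m : ℕ} (hm : p + 2 = m) {x : Form n} (hx : x ∈ bidegree n p 0)
    (u v : Fin n → ℂ) : x * hol n u * hol n v ∈ bidegree n m 0 :=
  mul_mem_bidegree' (mul_mem_bidegree' hx (hol_mem u) rfl rfl) (hol_mem v) (by omega) rfl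

theorem starTop_mul_lineForm₂ {p : ℕ} (hp : p + 2 = n) {x y : Form n}
    (hx : x ∈ bidegree n p 0) (hy : y ∈ bidegree n p 0) (u v : Fin n → ℂ) :
    starTop n (x * conjForm n y * (lineForm u * lineForm v)) =
      holVolNorm n / 4 * (holCoeff n (x * hol n u * hol n v) *
        conj (holCoeff n (y * hol n u * hol n v))) := by
  rw [mul_conj_mul_lineForm₂ hy, map_smul, starTop_mul_conjForm (mul_hol_hol_mem hp hx u v)
    (mul_hol_hol_mem hp hy u v), smul_eq_mul]
  ring

theorem starTop_mul_discForm {p : ℕ} (hp : p + 2 = n) {x y : Form n}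
    (hx : x ∈ bidegree n p 0) (hy : y ∈ bidegree n p 0) (w : Fin n → Fin n → ℂ)
    (B : Fin n → PosHerm) :
    starTop n (x * conjForm n y * discForm w B) =
      holVolNorm n / 8 * ∑ k, ∑ l, (B k).mixed (B l) *
        (holCoeff n (x * hol n (w k) * hol n (w l)) *
          conj (holCoeff n (y * hol n (w k) * hol n (w l)))) := by
  simp only [discForm, mul_smul_comm, Finset.mul_sum, map_smul, map_sum,
    starTop_mul_lineForm₂ hp hx hy, smul_eq_mul]
  refine Finset.sum_congr rfl fun k _ => Finset.sum_congr rfl fun l _ => ?_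
  ring

theorem eq_zero_of_holCoeff {x : Form n} (hx : x ∈ bidegree n n 0) (h : holCoeff n x = 0) :
    x = 0 := by
  rw [eq_holCoeff_smul hx, h, zero_smul]

theorem eq_zero_of_mul_hol_hol {p q : ℕ} (hp : p + 1 < n) {x : Form n}
    (hx : x ∈ bidegree n p q) (v w : Module.Basis (Fin n) ℂ (Fin n → ℂ))
    (h : ∀ k l, x * hol n (v k) * hol n (w l) = 0) : x = 0 := by
  refine eq_zero_of_mul_hol (by omega) hx v fun k => ?_
  have hx' : x * hol n (v k) ∈ bidegree n (p + 1) q :=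
    mul_mem_bidegree' hx (hol_mem _) rfl rfl
  exact eq_zero_of_mul_hol hp hx' w fun l => h k l

/-- On `V^{n-2,0}` the Hodge form of the determinant is a sum of squares with positive weights. -/
theorem starTop_discForm_of_zero {p : ℕ} (hp : p + 2 = n)
    (w : Module.Basis (Fin n) ℂ (Fin n → ℂ)) (B : Fin n → PosHerm) {x : Form n}
    (hx : x ∈ bidegree n p 0) :
    ∃ r : ℝ, starTop n (x * conjForm n x * discForm w B) = holVolNorm n * r ∧ 0 ≤ r ∧
      (r = 0 → x = 0) := by
  have hnn : ∀ k l, 0 ≤ (B k).mixed (B l) *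
      Complex.normSq (holCoeff n (x * hol n (w k) * hol n (w l))) := fun k l =>
    mul_nonneg (PosHerm.mixed_pos _ _).le (Complex.normSq_nonneg _)
  refine ⟨1 / 8 * ∑ k, ∑ l, (B k).mixed (B l) *
    Complex.normSq (holCoeff n (x * hol n (w k) * hol n (w l))), ?_, ?_, fun h0 => ?_⟩
  · rw [starTop_mul_discForm hp hx hx]
    simp only [Complex.mul_conj]
    push_cast
    ring
  · exact mul_nonneg (by norm_num)
      (Finset.sum_nonneg fun k _ => Finset.sum_nonneg fun l _ => hnn k l)
  · refine eq_zero_of_mul_hol_hol (by omega) hx w w fun k l => ?_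
    have h1 := (mul_eq_zero.1 h0).resolve_left (by norm_num)
    have h2 := (Finset.sum_eq_zero_iff_of_nonneg fun k _ =>
      Finset.sum_nonneg fun l _ => hnn k l).1 h1 k (Finset.mem_univ k)
    have h3 := (Finset.sum_eq_zero_iff_of_nonneg fun l _ => hnn k l).1 h2 l (Finset.mem_univ l)
    exact eq_zero_of_holCoeff (mul_hol_hol_mem hp hx _ _)
      (Complex.normSq_eq_zero.1 ((mul_eq_zero.1 h3).resolve_left (PosHerm.mixed_pos _ _).ne'))

/-- For `a ∈ V^{n-4,0}`, the product `a ∧ ā ∧ ω² ∧ Ω` is a sum of squares with positive weights. -/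
theorem starTop_kahler_sq_discForm {p : ℕ} (hp : p + 4 = n)
    (w : Module.Basis (Fin n) ℂ (Fin n → ℂ)) (B : Fin n → PosHerm) {ω : Form n}
    (hω : IsKahler ω) {x : Form n} (hx : x ∈ bidegree n p 0) :
    ∃ r : ℝ, starTop n (x * conjForm n x * (ω * ω * discForm w B)) = holVolNorm n * r ∧ 0 ≤ r ∧
      (r = 0 → x = 0) := by
  obtain ⟨v, rfl⟩ := isKahler_iff.1 hω
  have hmem : ∀ j k, x * hol n (v j) * hol n (v k) ∈ bidegree n (p + 2) 0 := fun j k =>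
    mul_hol_hol_mem rfl hx _ _
  choose r hr hr0 hrz using fun j k => starTop_discForm_of_zero (by omega) w B (hmem j k)
  refine ⟨1 / 4 * ∑ j, ∑ k, r j k, ?_, ?_, fun h0 => ?_⟩
  · simp only [Finset.sum_mul, Finset.mul_sum, map_sum]
    rw [Finset.sum_comm]
    push_cast
    simp only [Finset.mul_sum]
    refine Finset.sum_congr rfl fun j _ => Finset.sum_congr rfl fun k _ => ?_
    rw [← mul_assoc, mul_conj_mul_lineForm₂ hx, smul_mul_assoc, map_smul, hr, smul_eq_mul]
    ring
  · exact mul_nonneg (by norm_num)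
      (Finset.sum_nonneg fun j _ => Finset.sum_nonneg fun k _ => hr0 j k)
  · refine eq_zero_of_mul_hol_hol (by omega) hx v v fun j k => hrz j k ?_
    have h1 := (mul_eq_zero.1 h0).resolve_left (by norm_num)
    have h2 := (Finset.sum_eq_zero_iff_of_nonneg fun j _ =>
      Finset.sum_nonneg fun k _ => hr0 j k).1 h1 j (Finset.mem_univ j)
    exact (Finset.sum_eq_zero_iff_of_nonneg fun k _ => hr0 j k).1 h2 k (Finset.mem_univ k)

theorem mul_conj_mul_eq_zero {k : ℕ} {x X : Form n} (hX : X ∈ bidegree n k k)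
    (h : x * X = 0) : x * conjForm n x * X = 0 := by
  rw [mul_assoc, mul_comm_of_mem_diag hX, ← mul_assoc, h, zero_mul]

/-! ### The Hodge form on `V^{n-3,1}` -/

/-- A linear choice of `β_j ∈ V^{p,0}` with `α = ∑ β_j ∧ w̄_j`. -/
theorem exists_antihol_expansion (p : ℕ) (w : Module.Basis (Fin n) ℂ (Fin n → ℂ)) :
    ∃ β : Fin n → (bidegree n p 1 →ₗ[ℂ] bidegree n p 0),
      ∀ α : bidegree n p 1, (α : Form n) = ∑ j, (β j α : Form n) * conjForm n (hol n (w j)) := by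
  let Φ : (Fin n → bidegree n p 0) →ₗ[ℂ] bidegree n p 1 :=
    ∑ j, (((LinearMap.mulRight ℂ (conjForm n (hol n (w j)))).restrict
      (p := bidegree n p 0) (q := bidegree n p 1)
      fun x hx => mul_mem_bidegree' hx (conj_hol_mem (w j)) rfl (by omega)).comp
        (LinearMap.proj j))
  have hΦ : ∀ b, (Φ b : Form n) = ∑ j, (b j : Form n) * conjForm n (hol n (w j)) := by
    intro b
    simp only [Φ, LinearMap.sum_apply, Submodule.coe_sum]
    rfl
  have hsurj : Function.Surjective Φ := by
    have hle : bidegree n p 1 ≤ (LinearMap.range Φ).map (bidegree n p 1).subtype := by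
      have h1 : bidegree n p 1 = bidegree n p 0 * LinearMap.range (antihol n) := by
        simp [bidegree]
      conv_lhs => rw [h1]
      rw [Submodule.mul_le]
      rintro a ha _ ⟨b, rfl⟩
      have hb : antihol n b = ∑ j, conj (w.repr (fun j => conj (b j)) j) •
          conjForm n (hol n (w j)) := by
        have h2 : antihol n b = conjForm n (hol n (fun j => conj (b j))) := by
          rw [conjForm_hol]
          simp
        rw [h2]
        conv_lhs => rw [← w.sum_repr (fun j => conj (b j))]
        rw [map_sum, map_sum]
        refine Finset.sum_congr rfl fun j _ => ?_
        rw [map_smul, conjForm_smul]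
      refine ⟨Φ fun j => conj (w.repr (fun j => conj (b j)) j) • ⟨a, ha⟩, ⟨_, rfl⟩, ?_⟩
      rw [Submodule.subtype_apply, hΦ, hb, Finset.mul_sum]
      refine Finset.sum_congr rfl fun j _ => ?_
      rw [Submodule.coe_smul, smul_mul_assoc, mul_smul_comm]
    intro α
    obtain ⟨x, ⟨b, rfl⟩, hx⟩ := hle α.2
    exact ⟨b, Subtype.ext hx⟩
  obtain ⟨g, hg⟩ := LinearMap.exists_rightInverse_of_surjective Φ (LinearMap.range_eq_top.2 hsurj)
  refine ⟨fun j => (LinearMap.proj j).comp g, fun α => ?_⟩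
  have := hΦ (g α)
  rw [← LinearMap.comp_apply, hg] at this
  exact this

theorem sum_antihol_mul_conj {p : ℕ} (β : Fin n → Form n) (hβ : ∀ j, β j ∈ bidegree n p 0)
    (w : Fin n → Fin n → ℂ) :
    (∑ j, β j * conjForm n (hol n (w j))) *
        conjForm n (∑ j, β j * conjForm n (hol n (w j))) =
      -∑ j, ∑ j', β j * hol n (w j') * conjForm n (β j' * hol n (w j)) := by
  rw [map_sum, Finset.sum_mul_sum, ← Finset.sum_neg_distrib]
  refine Finset.sum_congr rfl fun j _ => ?_
  rw [← Finset.sum_neg_distrib]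
  refine Finset.sum_congr rfl fun j' _ => ?_
  have h1 : conjForm n (hol n (w j)) * conjForm n (β j') =
      (-1 : ℂ) ^ p • (conjForm n (β j') * conjForm n (hol n (w j))) := by
    have := bidegree_mul_comm (conj_hol_mem (w j)) (conjForm_mem_bidegree (hβ j'))
    simpa using this
  have h2 : conjForm n (β j' * hol n (w j)) * hol n (w j') =
      (-1 : ℂ) ^ (p + 1) • (hol n (w j') * conjForm n (β j' * hol n (w j))) := by
    have hm : β j' * hol n (w j) ∈ bidegree n (p + 1) 0 :=
      mul_mem_bidegree' (hβ j') (hol_mem _) rfl rfl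
    have := bidegree_mul_comm (conjForm_mem_bidegree hm) (hol_mem (w j'))
    simpa using this
  have h3 : ((-1 : ℂ) ^ p) * (-1) ^ (p + 1) = -1 := by
    rw [← pow_add]
    exact Odd.neg_one_pow ⟨p, by ring⟩
  rw [map_mul, conjForm_conjForm, mul_assoc (β j), ← mul_assoc (conjForm n (hol n (w j))), h1,
    smul_mul_assoc, ← map_mul, h2, smul_smul, h3, neg_smul, one_smul, mul_neg, mul_assoc]

/-- The coefficients `h_j(k,l,m)` of `β_j ∧ w_k ∧ w_l ∧ w_m`. -/
noncomputable def mixedCoeff (w : Fin n → Fin n → ℂ) (β : Fin n → Form n)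
    (j k l m : Fin n) : ℂ :=
  holCoeff n (β j * hol n (w k) * hol n (w l) * hol n (w m))

theorem isAltCoeff_mixedCoeff (w : Fin n → Fin n → ℂ) (β : Fin n → Form n) :
    IsAltCoeff (mixedCoeff w β) where
  swap_left j k l m := by
    unfold mixedCoeff
    rw [mul_assoc (β j), hol_mul_hol, mul_neg, neg_mul, map_neg, ← mul_assoc]
  swap_right j k l m := by
    unfold mixedCoeff
    rw [mul_assoc (_ * _), hol_mul_hol, mul_neg, map_neg, ← mul_assoc]

theorem sum_fin_four (F : Fin n → Fin n → Fin n → Fin n → ℂ) :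
    ∑ s : Fin 4 → Fin n, F (s 0) (s 1) (s 2) (s 3) = ∑ i, ∑ j, ∑ k, ∑ l, F i j k l := by
  let e : (Fin 4 → Fin n) ≃ Fin n × Fin n × Fin n × Fin n :=
    { toFun := fun s => (s 0, s 1, s 2, s 3)
      invFun := fun p => ![p.1, p.2.1, p.2.2.1, p.2.2.2]
      left_inv := fun s => by
        ext i
        fin_cases i <;> rfl
      right_inv := fun p => rfl }
  refine (Fintype.sum_equiv e _ (fun p => F p.1 p.2.1 p.2.2.1 p.2.2.2) fun s => rfl).trans ?_
  simp only [Fintype.sum_prod_type]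

/-- The complex sum is real, because exchanging `j` and `j'` conjugates its terms. -/
theorem sum_pairTerm_eq (B : Fin n → PosHerm) (h : Fin n → Fin n → Fin n → Fin n → ℂ) :
    ((∑ s, pairTerm B h s : ℝ) : ℂ) =
      ∑ j, ∑ j', ∑ k, ∑ l, ((B k).mixed (B l) : ℂ) * (h j j' k l * conj (h j' j k l)) := by
  have h4 : ∀ z : ℂ, (z.re : ℂ) = (z + conj z) / 2 := fun z => by
    rw [Complex.add_conj]
    push_cast
    ring
  simp only [pairTerm]
  push_cast
  simp only [h4]
  rw [sum_fin_four fun j j' k l => ((B k).mixed (B l) : ℂ) *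
    ((h j j' k l * conj (h j' j k l) + conj (h j j' k l * conj (h j' j k l))) / 2)]
  have hs : ∑ j, ∑ j', ∑ k, ∑ l, ((B k).mixed (B l) : ℂ) *
      conj (h j j' k l * conj (h j' j k l)) =
      ∑ j, ∑ j', ∑ k, ∑ l, ((B k).mixed (B l) : ℂ) * (h j j' k l * conj (h j' j k l)) := by
    rw [Finset.sum_comm]
    simp only [map_mul, Complex.conj_conj]
    refine Finset.sum_congr rfl fun j _ => Finset.sum_congr rfl fun j' _ =>
      Finset.sum_congr rfl fun k _ => Finset.sum_congr rfl fun l _ => ?_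
    ring
  have hsplit : ∀ c z z' : ℂ, c * ((z + z') / 2) = (1 / 2) * (c * z) + (1 / 2) * (c * z') := by
    intros
    ring
  simp only [hsplit, Finset.sum_add_distrib, ← Finset.mul_sum]
  rw [hs]
  ring

theorem starTop_discForm_eq {p : ℕ} (hp : p + 3 = n) (w : Fin n → Fin n → ℂ)
    (B : Fin n → PosHerm) (β : Fin n → Form n) (hβ : ∀ j, β j ∈ bidegree n p 0) :
    starTop n ((∑ j, β j * conjForm n (hol n (w j))) *
        conjForm n (∑ j, β j * conjForm n (hol n (w j))) * discForm w B) =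
      -(holVolNorm n * ((1 / 8 * ∑ s, pairTerm B (mixedCoeff w β) s : ℝ) : ℂ)) := by
  have hm : ∀ j j', β j * hol n (w j') ∈ bidegree n (p + 1) 0 := fun j j' =>
    mul_mem_bidegree' (hβ j) (hol_mem _) rfl rfl
  rw [sum_antihol_mul_conj β hβ, neg_mul, map_neg, Finset.sum_mul, map_sum, Complex.ofReal_mul,
    sum_pairTerm_eq, neg_inj]
  simp only [Finset.sum_mul, map_sum, starTop_mul_discForm (show p + 1 + 2 = n by omega)
    (hm _ _) (hm _ _), Finset.mul_sum]
  refine Finset.sum_congr rfl fun j _ => Finset.sum_congr rfl fun j' _ =>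
      Finset.sum_congr rfl fun k _ => Finset.sum_congr rfl fun l _ => ?_
  unfold mixedCoeff
  push_cast
  ring

/-- Up to its constant factor, the Hodge form on `V^{n-3,1}` is real, and positive definite on the
intersection of `n.choose 4` hyperplanes, one for each set of four indices. -/
theorem exists_hyperplanes {p : ℕ} (hp : p + 3 = n) (w : Module.Basis (Fin n) ℂ (Fin n → ℂ))
    (B : Fin n → PosHerm) :
    ∃ T : bidegree n p 1 →ₗ[ℂ] ({S : Finset (Fin n) // S.card = 4} → ℂ),
      ∀ α : bidegree n p 1, ∃ r : ℝ,
        starTop n ((α : Form n) * conjForm n (α : Form n) * discForm w B) =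
          -(holVolNorm n * r) ∧ (T α = 0 → 0 ≤ r ∧ (r = 0 → α = 0)) := by
  obtain ⟨β, hβ⟩ := exists_antihol_expansion p w
  choose t ht using fun m : Fin 4 → Fin n => exists_complForm_neg (B ∘ m)
  let H : Fin n → Fin n → Fin n → Fin n → (bidegree n p 1 →ₗ[ℂ] ℂ) := fun j k l m =>
    (((holCoeff n).comp (LinearMap.mulRight ℂ (hol n (w k) * hol n (w l) * hol n (w m)))).comp
      (bidegree n p 0).subtype).comp (β j)
  have hH : ∀ α j k l m, H j k l m α = mixedCoeff w (fun j => (β j α : Form n)) j k l m := by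
    intro α j k l m
    simp [H, mixedCoeff, mul_assoc]
  let C : (Fin 4 → Fin n) → Fin 4 → (bidegree n p 1 →ₗ[ℂ] ℂ) := fun s =>
    ![H (s 0) (s 1) (s 2) (s 3), -H (s 1) (s 0) (s 2) (s 3), H (s 2) (s 0) (s 1) (s 3),
      -H (s 3) (s 0) (s 1) (s 2)]
  have hC : ∀ α s i, C s i α = blockCoeff (mixedCoeff w fun j => (β j α : Form n)) s i := by
    intro α s i
    fin_cases i <;> simp [C, blockCoeff, hH]
  refine ⟨LinearMap.pi fun S => ∑ i, t (S.1.orderEmbOfFin S.2) i • C (S.1.orderEmbOfFin S.2) i,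
    fun α => ⟨1 / 8 * ∑ s, pairTerm B (mixedCoeff w fun j => (β j α : Form n)) s, ?_, ?_⟩⟩
  · conv_lhs => rw [hβ α]
    exact starTop_discForm_eq hp w B _ fun j => (β j α).2
  · intro hT
    have hpos := sum_pairTerm_pos (isAltCoeff_mixedCoeff w fun j => (β j α : Form n)) B (by
      intro m hm
      refine ht m _ ?_
      have hcard : (Finset.univ.image m).card = 4 := by
        rw [Finset.card_image_of_injective _ hm.injective, Finset.card_univ, Fintype.card_fin]
      have hme : m = (Finset.univ.image m).orderEmbOfFin hcard :=
        Finset.orderEmbOfFin_unique hcard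
          (fun i => Finset.mem_image_of_mem _ (Finset.mem_univ i)) hm
      have h1 := congrFun hT ⟨Finset.univ.image m, hcard⟩
      simp only [LinearMap.pi_apply, LinearMap.sum_apply, LinearMap.smul_apply, hC, smul_eq_mul,
        Pi.zero_apply] at h1
      rw [← hme] at h1
      exact h1)
    refine ⟨mul_nonneg (by norm_num) hpos.1, fun h0 => ?_⟩
    have hz := hpos.2 ((mul_eq_zero.1 h0).resolve_left (by norm_num))
    have hβ0 : ∀ j, (β j α : Form n) = 0 := by
      intro j
      refine eq_zero_of_mul_hol_hol (by omega) (β j α).2 w w fun k l => ?_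
      have hm : (β j α : Form n) * hol n (w k) * hol n (w l) ∈ bidegree n (p + 2) 0 :=
        mul_hol_hol_mem rfl (β j α).2 _ _
      refine eq_zero_of_mul_hol (by omega) hm w fun m => ?_
      refine eq_zero_of_holCoeff (mul_mem_bidegree' hm (hol_mem _) (by omega) rfl) ?_
      exact congrFun (congrFun (congrFun (congrFun hz j) k) l) m
    apply Subtype.ext
    rw [hβ α]
    simp [hβ0]

/-! ### The Hodge-Riemann relations -/

/-- Triangular numbers with indices differing by two have different parities. -/
theorem neg_one_pow_triangle (m : ℕ) :
    (-1 : ℂ) ^ (m * (m - 1) / 2) * (-1) ^ ((m + 2) * (m + 2 - 1) / 2) = -1 := by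
  have h : (m + 2) * (m + 2 - 1) / 2 = m * (m - 1) / 2 + (2 * m + 1) := by
    rcases m with _ | m
    · rfl
    · simp only [Nat.add_sub_cancel, show m + 1 + 2 - 1 = m + 2 by omega]
      rw [show (m + 1 + 2) * (m + 2) = (m + 1) * m + (2 * (m + 1) + 1) * 2 by ring,
        Nat.add_mul_div_right _ _ two_pos]
  rw [h, ← pow_add]
  exact Odd.neg_one_pow ⟨m * (m - 1) / 2 + m, by ring⟩

/-- The signs in the Hodge form cancel those of the top degree coefficient of `Z ∧ Z̄`. -/
theorem hodgeSign_mul_norm_zero {p : ℕ} (hp : p + 2 = n) :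
    Complex.I ^ ((p : ℤ) - ((0 : ℕ) : ℤ)) * (-1) ^ ((p + 0) * (p + 0 - 1) / 2) * holVolNorm n =
      2 ^ n := by
  subst hp
  have h := neg_one_pow_triangle p
  have hI : Complex.I ^ p * (-2 * Complex.I) ^ (p + 2) = -2 ^ (p + 2) := by
    rw [pow_add, ← mul_assoc, ← mul_pow,
      show Complex.I * (-2 * Complex.I) = 2 by linear_combination (-2) * Complex.I_mul_I, pow_add]
    linear_combination 4 * 2 ^ p * Complex.I_sq
  simp only [Nat.cast_zero, sub_zero, zpow_natCast, add_zero, holVolNorm]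
  linear_combination Complex.I ^ p * (-2 * Complex.I) ^ (p + 2) * h - hI

theorem hodgeSign_mul_norm_one {p : ℕ} (hp : p + 4 = n) :
    Complex.I ^ (((p + 1 : ℕ) : ℤ) - ((1 : ℕ) : ℤ)) *
      (-1) ^ ((p + 1 + 1) * (p + 1 + 1 - 1) / 2) * holVolNorm n = -2 ^ n := by
  subst hp
  have h := neg_one_pow_triangle (p + 2)
  have hI : Complex.I ^ p * (-2 * Complex.I) ^ (p + 4) = 2 ^ (p + 4) := by
    rw [pow_add, ← mul_assoc, ← mul_pow,
      show Complex.I * (-2 * Complex.I) = 2 by linear_combination (-2) * Complex.I_mul_I, pow_add,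
      mul_pow, Complex.I_pow_four]
    norm_num
  simp only [Nat.cast_add, Nat.cast_one, add_sub_cancel_right, zpow_natCast, holVolNorm]
  linear_combination Complex.I ^ p * (-2 * Complex.I) ^ (p + 4) * h - hI

theorem two_pow_mul_re_im (n : ℕ) {r : ℝ} (hr : 0 < r) :
    0 < ((2 : ℂ) ^ n * r).re ∧ ((2 : ℂ) ^ n * r).im = 0 := by
  have h : (2 : ℂ) ^ n * r = ((2 ^ n * r : ℝ) : ℂ) := by
    push_cast
    ring
  rw [h, Complex.ofReal_re, Complex.ofReal_im]
  exact ⟨by positivity, rfl⟩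

theorem isLefschetz_discForm_zero {p : ℕ} (hp : p + 2 = n)
    (w : Module.Basis (Fin n) ℂ (Fin n → ℂ)) (B : Fin n → PosHerm) :
    IsLefschetz (discForm w B) p 0 := by
  refine isLefschetz_of_injective (k := 2) (by omega) (discForm_mem w B) fun α hα h0 => ?_
  obtain ⟨r, hr, -, hz⟩ := starTop_discForm_of_zero hp w B hα
  rw [mul_conj_mul_eq_zero (discForm_mem w B) h0, map_zero] at hr
  exact hz (by exact_mod_cast (mul_eq_zero.1 hr.symm).resolve_left holVolNorm_ne_zero)

theorem satisfiesHRR_discForm_zero {p : ℕ} (hp : p + 2 = n)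
    (w : Module.Basis (Fin n) ℂ (Fin n → ℂ)) (B : Fin n → PosHerm) (ω : Form n) :
    SatisfiesHRR (discForm w B) ω p 0 := by
  intro α hα hne
  obtain ⟨r, hr, h0, hz⟩ := starTop_discForm_of_zero hp w B hα.1
  rw [hodgeForm, hr, ← mul_assoc, hodgeSign_mul_norm_zero hp]
  exact two_pow_mul_re_im n (lt_of_le_of_ne h0 fun h => hne (hz h.symm))

theorem satisfiesLD_zero {p : ℕ} (hp : p + 2 = n) {Ω ω : Form n} (hΩ : Ω ∈ bidegree n 2 2)
    (hω : ω ∈ bidegree n 1 1) : SatisfiesLD Ω ω p 0 := by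
  have h1 : lefschetzImage ω p 0 = ⊥ := if_neg (by omega)
  have h2 : primitive Ω ω p 0 = bidegree n p 0 := by
    refine inf_eq_left.2 fun α hα => ?_
    rw [LinearMap.mem_ker, LinearMap.mulRight_apply]
    have hm : α * (Ω * ω) ∈ bidegree n (p + 3) 3 :=
      mul_mem_bidegree' hα (mul_mem_bidegree' hΩ hω rfl rfl) (by omega) (by omega)
    exact eq_zero_of_mem_bidegree_of_lt (by omega) hm
  refine ⟨by rw [h1, bot_inf_eq], by rw [h1, h2, bot_sup_eq], ?_⟩
  rintro α hα β -
  rw [h1, Submodule.mem_bot] at hα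
  simp [hα, hodgeForm]

/-- Orthogonality of `ω ∧ a` and a primitive form `x`. -/
theorem mul_conj_primitive_eq_zero {Ω ω x : Form n}
    (hω : ω ∈ bidegree n 1 1) (hΩc : conjForm n Ω = Ω) (hωc : conjForm n ω = ω)
    (hx : x * (Ω * ω) = 0) (a : Form n) : ω * a * conjForm n x * Ω = 0 := by
  have h := congrArg (conjForm n) hx
  rw [map_mul, map_mul, hΩc, hωc, map_zero, ← mul_assoc] at h
  rw [mul_assoc, mul_assoc, ← mul_comm_of_mem_diag hω, mul_assoc, mul_assoc, ← mul_assoc _ Ω, h,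
    mul_zero]

theorem primitive_mul_conj_eq_zero {Ω ω x : Form n} {k : ℕ} (hΩ : Ω ∈ bidegree n k k)
    (hωc : conjForm n ω = ω)
    (hx : x * (Ω * ω) = 0) (a : Form n) : x * conjForm n (ω * a) * Ω = 0 := by
  rw [map_mul, hωc, mul_assoc, mul_comm_of_mem_diag hΩ, ← mul_assoc Ω, ← mul_assoc, hx, zero_mul]

/-- The Hodge-Riemann relations in bidegree `(n-3,1)`. The Hodge form is negative definite on
`ω ∧ V^{n-4,0}`, of dimension `n.choose 4`, and positive definite on a subspace of codimension at
most `n.choose 4`. Hence it is positive definite on the orthogonal complement of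
`ω ∧ V^{n-4,0}`, which is the primitive space. -/
theorem satisfiesHRR_discForm_one {p : ℕ} (hp : p + 4 = n)
    (w : Module.Basis (Fin n) ℂ (Fin n → ℂ)) (B : Fin n → PosHerm) {ω : Form n}
    (hω : IsKahler ω) : SatisfiesHRR (discForm w B) ω (p + 1) 1 := by
  intro x hx hne
  have hxm : x ∈ bidegree n (p + 1) 1 := hx.1
  have hxp : x * (discForm w B * ω) = 0 := hx.2
  obtain ⟨T, hT⟩ := exists_hyperplanes (show p + 1 + 3 = n by omega) w B
  let L : bidegree n p 0 →ₗ[ℂ] bidegree n (p + 1) 1 :=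
    (LinearMap.mulLeft ℂ ω).restrict fun a ha =>
      mul_mem_bidegree' hω.mem ha (by omega) (by omega)
  let Φ : (ℂ × bidegree n p 0) →ₗ[ℂ] bidegree n (p + 1) 1 :=
    (LinearMap.toSpanSingleton ℂ _ ⟨x, hxm⟩).coprod L
  have hΦ : ∀ c a, ((Φ (c, a) : bidegree n (p + 1) 1) : Form n) = c • x + ω * a := fun c a => rfl
  -- Dimension count: `1 + n.choose 4` unknowns `(c, a)` and `n.choose 4` equations.
  have hker : LinearMap.ker (T.comp Φ) ≠ ⊥ := by
    apply LinearMap.ker_ne_bot_of_finrank_lt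
    rw [Module.finrank_prod, Module.finrank_self, finrank_bidegree_zero_right,
      Module.finrank_fintype_fun_eq_card, Fintype.card_finset_len, Fintype.card_fin,
      ← Nat.choose_symm_of_eq_add (show n = p + 4 by omega)]
    omega
  obtain ⟨⟨c, a⟩, hca, hca0⟩ := (Submodule.ne_bot_iff _).1 hker
  have hTy : T (Φ (c, a)) = 0 := hca
  obtain ⟨rx, hrx, -⟩ := hT ⟨x, hxm⟩
  obtain ⟨ry, hry, hry'⟩ := hT (Φ (c, a))
  obtain ⟨hry0, hryz⟩ := hry' hTy
  obtain ⟨ra, hra, hra0, hraz⟩ := starTop_kahler_sq_discForm hp w B hω a.2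
  have h1 := mul_conj_primitive_eq_zero hω.mem (conjForm_discForm w B)
    hω.conj_eq hxp a
  have h2 := primitive_mul_conj_eq_zero (discForm_mem w B) hω.conj_eq hxp (a : Form n)
  have h3 : ω * (a : Form n) * conjForm n (ω * a) * discForm w B =
      a * conjForm n a * (ω * ω * discForm w B) := by
    rw [map_mul, hω.conj_eq, ← mul_comm_of_mem_diag hω.mem, ← mul_comm_of_mem_diag hω.mem]
    simp only [mul_assoc]
    rw [← mul_assoc ω (conjForm n _), ← mul_comm_of_mem_diag hω.mem, mul_assoc]
  -- `Q` at `c x + ω ∧ a`, without cross terms by orthogonality.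
  have hsum : ry = Complex.normSq c * rx - ra := by
    have h4 : (c • x + ω * a) * conjForm n (c • x + ω * a) * discForm w B =
        (c * conj c) • (x * conjForm n x * discForm w B) +
          a * conjForm n a * (ω * ω * discForm w B) := by
      rw [map_add, conjForm_smul, add_mul, mul_add, mul_add, add_mul, add_mul, add_mul, h3,
        smul_mul_smul_comm, smul_mul_assoc, smul_mul_assoc, smul_mul_assoc, h2, mul_smul_comm,
        smul_mul_assoc, h1]
      simp
    rw [hΦ, h4, map_add, map_smul, hrx, hra, Complex.mul_conj, smul_eq_mul] at hry
    have h5 : holVolNorm n * (ry : ℂ) = holVolNorm n * ((Complex.normSq c * rx - ra : ℝ) : ℂ) := by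
      push_cast
      linear_combination hry
    exact_mod_cast mul_left_cancel₀ holVolNorm_ne_zero h5
  have hc : c ≠ 0 := by
    rintro rfl
    rw [Complex.normSq_zero, zero_mul, zero_sub] at hsum
    have : a = 0 := Subtype.ext (hraz (by linarith))
    exact hca0 (by rw [this]; rfl)
  have hcpos := Complex.normSq_pos.2 hc
  have hrx0 : 0 ≤ rx := nonneg_of_mul_nonneg_right (by linarith) hcpos
  have hrxpos : 0 < rx := by
    refine lt_of_le_of_ne hrx0 fun h => hne ?_
    rw [← h, mul_zero] at hsum
    have ha : (a : Form n) = 0 := hraz (by linarith)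
    have hy := congrArg Subtype.val (hryz (by linarith))
    rw [hΦ, ha, mul_zero, add_zero] at hy
    exact (smul_eq_zero.1 hy).resolve_left hc
  have hrx' : starTop n (x * conjForm n x * discForm w B) = -(holVolNorm n * rx) := hrx
  rw [hodgeForm, hrx', ← neg_mul, ← mul_assoc, mul_neg, hodgeSign_mul_norm_one hp, neg_neg]
  exact two_pow_mul_re_im n hrxpos

theorem isLefschetz_discForm_one {p : ℕ} (hp : p + 4 = n)
    (w : Module.Basis (Fin n) ℂ (Fin n → ℂ)) (B : Fin n → PosHerm) {ω : Form n}
    (hω : IsKahler ω) : IsLefschetz (discForm w B) (p + 1) 1 := by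
  refine isLefschetz_of_injective (k := 2) (by omega) (discForm_mem w B) fun α hα h0 => ?_
  by_contra hne
  have hprim : α ∈ primitive (discForm w B) ω (p + 1) 1 := by
    refine ⟨hα, ?_⟩
    change α * (discForm w B * ω) = 0
    rw [← mul_assoc, h0, zero_mul]
  have h := (satisfiesHRR_discForm_one hp w B hω α hprim hne).1
  rw [hodgeForm, mul_conj_mul_eq_zero (discForm_mem w B) h0, map_zero, mul_zero] at h
  exact lt_irrefl _ h

theorem isLefschetz_discForm_mul_sq {p : ℕ} (hp : p + 4 = n)
    (w : Module.Basis (Fin n) ℂ (Fin n → ℂ)) (B : Fin n → PosHerm) {ω : Form n}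
    (hω : IsKahler ω) : IsLefschetz (discForm w B * ω ^ 2) p 0 := by
  have hm : discForm w B * ω ^ 2 ∈ bidegree n 4 4 := by
    rw [pow_two]
    exact mul_mem_bidegree' (discForm_mem w B) (mul_mem_bidegree' hω.mem hω.mem rfl rfl) rfl rfl
  refine isLefschetz_of_injective (k := 4) (by omega) hm fun α hα h0 => ?_
  obtain ⟨r, hr, -, hz⟩ := starTop_kahler_sq_discForm hp w B hω hα
  rw [mul_comm_of_mem_diag (discForm_mem w B), ← pow_two, mul_conj_mul_eq_zero hm h0,
    map_zero] at hr
  exact hz (by exact_mod_cast (mul_eq_zero.1 hr.symm).resolve_left holVolNorm_ne_zero)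

theorem satisfiesLD_discForm_one {p : ℕ} (hp : p + 4 = n)
    (w : Module.Basis (Fin n) ℂ (Fin n → ℂ)) (B : Fin n → PosHerm) {ω : Form n}
    (hω : IsKahler ω) : SatisfiesLD (discForm w B) ω (p + 1) 1 := by
  have himg : lefschetzImage ω (p + 1) 1 = (bidegree n p 0).map (LinearMap.mulLeft ℂ ω) :=
    if_pos (by omega)
  have hL := isLefschetz_discForm_mul_sq hp w B hω
  have hcomm : ∀ a, ω * a * (discForm w B * ω) = a * (discForm w B * ω ^ 2) := by
    intro a
    rw [← mul_comm_of_mem_diag hω.mem a, mul_assoc, ← mul_assoc ω,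
      ← mul_comm_of_mem_diag hω.mem (discForm w B), pow_two, mul_assoc]
  refine ⟨?_, le_antisymm ?_ ?_, ?_⟩
  · rw [himg, Submodule.eq_bot_iff]
    rintro _ ⟨⟨a, ha, rfl⟩, -, hk⟩
    have hk' : ω * a * (discForm w B * ω) = 0 := hk
    rw [hcomm] at hk'
    rw [hL.eq_zero ha hk', map_zero]
  · rw [himg]
    refine sup_le ?_ inf_le_left
    rintro _ ⟨a, ha, rfl⟩
    exact mul_mem_bidegree' hω.mem ha (by omega) (by omega)
  · intro α hα
    have hm : α * (discForm w B * ω) ∈ bidegree n (n - 0) (n - p) :=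
      mul_mem_bidegree' hα (mul_mem_bidegree' (discForm_mem w B) hω.mem rfl rfl)
        (by omega) (by omega)
    obtain ⟨a, ha, haα⟩ := hL.2.2.surjOn hm
    have haα' : a * (discForm w B * ω ^ 2) = α * (discForm w B * ω) := haα
    refine Submodule.mem_sup.2 ⟨ω * a, ?_, α - ω * a, ⟨?_, ?_⟩, by abel⟩
    · rw [himg]
      exact ⟨a, ha, rfl⟩
    · exact sub_mem hα (mul_mem_bidegree' hω.mem ha (by omega) (by omega))
    · change (α - ω * a) * (discForm w B * ω) = 0
      rw [sub_mul, hcomm, haα', sub_self]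
  · rw [himg]
    rintro _ ⟨a, ha, rfl⟩ β ⟨-, hβ⟩
    have hβ' : β * (discForm w B * ω) = 0 := hβ
    rw [hodgeForm, LinearMap.mulLeft_apply, mul_conj_primitive_eq_zero hω.mem
      (conjForm_discForm w B) hω.conj_eq hβ' a, map_zero, mul_zero]

/-! ### Exchanging the two degrees by conjugation -/

theorem IsLefschetz.conj {p q k : ℕ} (h : p + q + k = n) {Ω : Form n}
    (hΩc : conjForm n Ω = Ω) (hL : IsLefschetz Ω p q) : IsLefschetz Ω q p := by
  have hΩ : Ω ∈ bidegree n k k := by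
    have := hL.2.1
    rwa [show n - p - q = k by omega] at this
  refine isLefschetz_of_injective (k := k) (by omega) hΩ fun α hα h0 => ?_
  have h1 := congrArg (conjForm n) h0
  rw [map_mul, hΩc, map_zero] at h1
  exact conjForm_injective (by rw [hL.eq_zero (conjForm_mem_bidegree hα) h1, map_zero])

theorem hodgeForm_conj {p q k : ℕ} (h : p + q + k = n) {Ω : Form n} (hΩ : Ω ∈ bidegree n k k)
    (hΩc : conjForm n Ω = Ω) {α β : Form n} (hα : α ∈ bidegree n q p) (hβ : β ∈ bidegree n q p) :
    hodgeForm Ω q p α β = conj (hodgeForm Ω p q (conjForm n α) (conjForm n β)) := by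
  have hm : conjForm n α * β * Ω ∈ bidegree n n n :=
    mul_mem_bidegree' (mul_mem_bidegree' (conjForm_mem_bidegree hα) hβ rfl rfl) hΩ
      (by omega) (by omega)
  have hI : conj (Complex.I ^ ((p : ℤ) - (q : ℤ))) = Complex.I ^ ((q : ℤ) - (p : ℤ)) := by
    rw [map_zpow₀, Complex.conj_I, ← Complex.inv_I, inv_zpow', neg_sub]
  have hs := starTop_conjForm hm
  rw [map_mul (conjForm n), map_mul (conjForm n), conjForm_conjForm, hΩc] at hs
  rw [hodgeForm, hodgeForm, conjForm_conjForm, map_mul (starRingEnd ℂ), map_mul (starRingEnd ℂ), hI,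
    ← hs, add_comm q p]
  simp

theorem conjForm_mem_primitive {p q : ℕ} {Ω ω α : Form n} (hΩc : conjForm n Ω = Ω)
    (hωc : conjForm n ω = ω) (hα : α ∈ primitive Ω ω p q) :
    conjForm n α ∈ primitive Ω ω q p := by
  refine ⟨conjForm_mem_bidegree hα.1, ?_⟩
  have h : α * (Ω * ω) = 0 := hα.2
  have h1 := congrArg (conjForm n) h
  rw [map_mul, map_mul, hΩc, hωc, map_zero] at h1
  exact h1

theorem conjForm_mem_lefschetzImage {p q : ℕ} {ω α : Form n} (hωc : conjForm n ω = ω)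
    (hα : α ∈ lefschetzImage ω p q) : conjForm n α ∈ lefschetzImage ω q p := by
  unfold lefschetzImage at hα ⊢
  split_ifs at hα with h
  · rw [if_pos h.symm]
    obtain ⟨a, ha, rfl⟩ := hα
    refine ⟨conjForm n a, conjForm_mem_bidegree ha, ?_⟩
    rw [LinearMap.mulLeft_apply, LinearMap.mulLeft_apply, map_mul, hωc]
  · rw [(Submodule.mem_bot ℂ).1 hα, map_zero]
    exact zero_mem _

theorem SatisfiesHRR.conj {p q k : ℕ} (h : p + q + k = n) {Ω ω : Form n}
    (hΩ : Ω ∈ bidegree n k k) (hΩc : conjForm n Ω = Ω) (hωc : conjForm n ω = ω)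
    (hR : SatisfiesHRR Ω ω p q) : SatisfiesHRR Ω ω q p := by
  intro α hα hne
  have h1 := hR _ (conjForm_mem_primitive hΩc hωc hα) fun h0 =>
    hne (conjForm_injective (by rw [h0, map_zero]))
  rw [hodgeForm_conj h hΩ hΩc hα.1 hα.1, Complex.conj_re, Complex.conj_im, h1.2]
  exact ⟨h1.1, neg_zero⟩

theorem SatisfiesLD.conj {p q k : ℕ} (h : p + q + k = n) {Ω ω : Form n}
    (hΩ : Ω ∈ bidegree n k k) (hΩc : conjForm n Ω = Ω) (hωc : conjForm n ω = ω)
    (hD : SatisfiesLD Ω ω p q) : SatisfiesLD Ω ω q p := by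
  obtain ⟨h1, h2, h3⟩ := hD
  have himg : lefschetzImage ω q p ≤ bidegree n q p := by
    intro α hα
    rw [← conjForm_conjForm α]
    refine conjForm_mem_bidegree (h2 ▸ Submodule.mem_sup_left ?_)
    exact conjForm_mem_lefschetzImage hωc hα
  refine ⟨?_, le_antisymm (sup_le himg inf_le_left) fun α hα => ?_, fun α hα β hβ => ?_⟩
  · rw [Submodule.eq_bot_iff]
    rintro α ⟨hα, hα'⟩
    have h4 : conjForm n α ∈ lefschetzImage ω p q ⊓ primitive Ω ω p q :=
      ⟨conjForm_mem_lefschetzImage hωc hα, conjForm_mem_primitive hΩc hωc hα'⟩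
    rw [h1, Submodule.mem_bot] at h4
    exact conjForm_injective (by rw [h4, map_zero])
  · have h4 := conjForm_mem_bidegree hα
    rw [← h2] at h4
    obtain ⟨a, ha, b, hb, hab⟩ := Submodule.mem_sup.1 h4
    rw [← conjForm_conjForm α, ← hab, map_add]
    exact Submodule.add_mem_sup (conjForm_mem_lefschetzImage hωc ha)
      (conjForm_mem_primitive hΩc hωc hb)
  · rw [hodgeForm_conj h hΩ hΩc (himg hα) hβ.1, h3 _ (conjForm_mem_lefschetzImage hωc hα) _
      (conjForm_mem_primitive hΩc hωc hβ), map_zero]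

/-- All three properties, in the bidegrees with `p ≤ 1` or `q ≤ 1`. -/
theorem hodgeRiemann_discForm {p q : ℕ} (hpq : p + q + 2 = n) (hmin : min p q ≤ 1)
    (w : Module.Basis (Fin n) ℂ (Fin n → ℂ)) (B : Fin n → PosHerm) {ω : Form n}
    (hω : IsKahler ω) :
    IsLefschetz (discForm w B) p q ∧ SatisfiesHRR (discForm w B) ω p q ∧
      SatisfiesLD (discForm w B) ω p q := by
  wlog hle : q ≤ p generalizing p q
  · obtain ⟨h1, h2, h3⟩ := this (p := q) (q := p) (by omega) (by omega) (by omega)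
    have hqp : q + p + 2 = n := by omega
    exact ⟨h1.conj hqp (conjForm_discForm w B),
      h2.conj hqp (discForm_mem w B) (conjForm_discForm w B) hω.conj_eq,
      h3.conj hqp (discForm_mem w B) (conjForm_discForm w B) hω.conj_eq⟩
  obtain rfl | rfl : q = 0 ∨ q = 1 := by omega
  · exact ⟨isLefschetz_discForm_zero hpq w B, satisfiesHRR_discForm_zero hpq w B ω,
      satisfiesLD_zero hpq (discForm_mem w B) hω.mem⟩
  · obtain ⟨p, rfl⟩ : ∃ p', p = p' + 1 := ⟨p - 1, by omega⟩
    have hp : p + 4 = n := by omega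
    exact ⟨isLefschetz_discForm_one hp w B hω, satisfiesHRR_discForm_one hp w B hω,
      satisfiesLD_discForm_one hp w B hω⟩

theorem isLefschetz_discForm_mul_pow {p q r : ℕ} (hpq : p + q + 2 = n) (hmin : min p q ≤ 1)
    (hr : r ≤ min p q) (w : Module.Basis (Fin n) ℂ (Fin n → ℂ)) (B : Fin n → PosHerm)
    {ω : Form n} (hω : IsKahler ω) :
    IsLefschetz (discForm w B * ω ^ (2 * r)) (p - r) (q - r) := by
  wlog hle : q ≤ p generalizing p q
  · have h1 := this (p := q) (q := p) (by omega) (by omega) (by omega) (by omega)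
    refine h1.conj (k := 2 + 2 * r) (by omega) ?_
    rw [map_mul, map_pow, conjForm_discForm, hω.conj_eq]
  obtain rfl | rfl : r = 0 ∨ r = 1 := by omega
  · rw [mul_zero, pow_zero, mul_one]
    exact (hodgeRiemann_discForm hpq hmin w B hω).1
  · obtain rfl : q = 1 := by omega
    exact isLefschetz_discForm_mul_sq (by omega) w B hω

/-! ### Kähler forms and positive definite matrices -/

/-- The `(1,1)` form `∑ H_{a,b} (√-1/2) dz_a ∧ dz̄_b`. -/
noncomputable def hermForm (H : Matrix (Fin n) (Fin n) ℂ) : Form n :=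
  ∑ a, ∑ b, H a b • ((Complex.I / 2) • (dz a * dzbar b))

theorem hermForm_add (H K : Matrix (Fin n) (Fin n) ℂ) :
    hermForm (H + K) = hermForm H + hermForm K := by
  simp only [hermForm, Matrix.add_apply, add_smul, Finset.sum_add_distrib]

theorem hermForm_smul (c : ℂ) (H : Matrix (Fin n) (Fin n) ℂ) :
    hermForm (c • H) = c • hermForm H := by
  simp only [hermForm, Matrix.smul_apply, smul_eq_mul, mul_smul, Finset.smul_sum]

theorem hermForm_diagonal (c : Fin n → ℂ) :
    hermForm (Matrix.diagonal c) = ∑ l, c l • areaForm l := by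
  unfold hermForm
  refine Finset.sum_congr rfl fun a _ => ?_
  rw [Finset.sum_eq_single a]
  · rw [Matrix.diagonal_apply_eq]
    rfl
  · intro b _ hb
    rw [Matrix.diagonal_apply_ne _ hb.symm, zero_smul]
  · intro h
    exact absurd (Finset.mem_univ a) h

theorem antihol_eq_sum (v : Fin n → ℂ) : antihol n v = ∑ l, v l • dzbar l := by
  conv_lhs => rw [pi_eq_sum_univ' v]
  rw [map_sum]
  refine Finset.sum_congr rfl fun l _ => ?_
  rw [map_smul]
  rfl

/-- Contraction with `∂/∂z_l` recovers the `l`-th row of `H`. -/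
theorem hermForm_injective : Function.Injective (hermForm (n := n)) := by
  have h : ∀ (H : Matrix (Fin n) (Fin n) ℂ) (l : Fin n),
      contractHol l (hermForm H) = (Complex.I / 2) • antihol n (H l) := by
    intro H l
    have h1 : ∀ b : Fin n, contractHol l (dzbar b) = 0 := by
      intro b
      have := contractHol_antihol_mul l (Pi.single b 1) 1
      rw [mul_one, ← map_one (algebraMap ℂ (Form n)), contractHol_algebraMap, mul_zero,
        neg_zero] at this
      exact this
    have h2 : ∀ a b : Fin n, contractHol l (dz a * dzbar b) =
        (Pi.single a 1 : Fin n → ℂ) l • dzbar b := by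
      intro a b
      rw [dz, contractHol_hol_mul, h1, mul_zero, sub_zero]
    simp only [hermForm, map_sum, map_smul, h2]
    rw [Finset.sum_eq_single l, antihol_eq_sum, Finset.smul_sum]
    · refine Finset.sum_congr rfl fun b _ => ?_
      rw [Pi.single_eq_same, one_smul, smul_comm]
    · intro a _ ha
      refine Finset.sum_eq_zero fun b _ => ?_
      rw [Pi.single_eq_of_ne ha.symm, zero_smul, smul_zero, smul_zero]
    · intro h
      exact absurd (Finset.mem_univ l) h
  intro H K hHK
  funext l
  have h1 := h H l
  rw [hHK, h K l] at h1
  have h2 : antihol n (K l) = antihol n (H l) :=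
    (smul_right_injective (Form n) (by simp : Complex.I / 2 ≠ 0)) h1
  have h3 := (ExteriorAlgebra.ι_inj ℂ _ _).1 h2
  exact (congrArg Prod.snd h3).symm

theorem sum_lineForm (C : Matrix (Fin n) (Fin n) ℂ) :
    ∑ l, lineForm (fun a => conj (C l a)) = hermForm (C.conjTranspose * C) := by
  unfold hermForm
  simp only [Matrix.mul_apply, Matrix.conjTranspose_apply, Finset.sum_smul]
  have h : ∀ l, lineForm (fun a => conj (C l a)) =
      ∑ a, ∑ b, (star (C l a) * C l b) • ((Complex.I / 2) • (dz a * dzbar b)) := by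
    intro l
    have h1 : conjForm n (hol n fun a => conj (C l a)) = antihol n (C l) := by
      rw [conjForm_hol]
      simp
    rw [lineForm, h1, hol_eq_sum, antihol_eq_sum, Finset.sum_mul_sum, Finset.smul_sum]
    refine Finset.sum_congr rfl fun a _ => ?_
    rw [Finset.smul_sum]
    refine Finset.sum_congr rfl fun b _ => ?_
    rw [smul_mul_smul_comm, smul_comm]
    rfl
  simp only [h]
  rw [Finset.sum_comm]
  refine Finset.sum_congr rfl fun a _ => ?_
  rw [Finset.sum_comm]

open scoped MatrixOrder Matrix.Norms.L2Operator in
theorem exists_eq_conjTranspose_mul_self {H : Matrix (Fin n) (Fin n) ℂ} (hH : H.PosDef) :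
    ∃ C : Matrix (Fin n) (Fin n) ℂ, IsUnit C ∧ H = C.conjTranspose * C :=
  CStarAlgebra.isStrictlyPositive_iff_eq_star_mul_self.mp hH.isStrictlyPositive

theorem isKahler_iff_posDef {ω : Form n} :
    IsKahler ω ↔ ∃ H : Matrix (Fin n) (Fin n) ℂ, H.PosDef ∧ ω = hermForm H := by
  rw [isKahler_iff]
  constructor
  · rintro ⟨v, rfl⟩
    let C : Matrix (Fin n) (Fin n) ℂ := Matrix.of fun l a => conj (v l a)
    refine ⟨C.conjTranspose * C, ?_, ?_⟩
    · refine Matrix.PosDef.conjTranspose_mul_self _ ?_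
      refine (Matrix.mulVec_injective_iff_isUnit).2 ?_
      rw [← Matrix.linearIndependent_rows_iff_isUnit]
      rw [Fintype.linearIndependent_iff]
      intro g hg
      have hv := Fintype.linearIndependent_iff.1 v.linearIndependent (fun i => conj (g i)) (by
        ext a
        have h1 := congrArg conj (congrFun hg a)
        simpa [C, Finset.sum_apply] using h1)
      intro i
      have := hv i
      simpa using this
    · rw [← sum_lineForm]
      simp [C]
  · rintro ⟨H, hH, rfl⟩
    obtain ⟨C, hC, rfl⟩ := exists_eq_conjTranspose_mul_self hH
    have hli : LinearIndependent ℂ fun l a => conj (C l a) := by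
      have h1 : IsUnit (C.conjTranspose.transpose) := by
        rw [Matrix.isUnit_transpose, Matrix.isUnit_conjTranspose]
        exact hC
      exact Matrix.linearIndependent_rows_iff_isUnit.2 h1
    refine ⟨Module.Basis.mk hli (hli.span_eq_top_of_card_eq_finrank' (by simp)).ge, ?_⟩
    simp only [Module.Basis.coe_mk, sum_lineForm]

/-- The segment between two Kähler forms consists of Kähler forms. -/
theorem IsKahler.interp {ω₀ ω₁ : Form n} (h₀ : IsKahler ω₀) (h₁ : IsKahler ω₁) {s : ℝ}
    (hs : s ∈ Set.Icc (0 : ℝ) 1) :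
    IsKahler (((1 - s : ℝ) : ℂ) • ω₀ + (s : ℂ) • ω₁) := by
  obtain ⟨hs0, hs1⟩ := hs
  rcases hs0.eq_or_lt with rfl | hs0
  · simpa using h₀
  rcases hs1.eq_or_lt with rfl | hs1
  · simpa using h₁
  obtain ⟨H, hH, rfl⟩ := isKahler_iff_posDef.1 h₀
  obtain ⟨K, hK, rfl⟩ := isKahler_iff_posDef.1 h₁
  refine isKahler_iff_posDef.2 ⟨((1 - s : ℝ) : ℂ) • H + (s : ℂ) • K, ?_, ?_⟩
  · refine (hH.smul ?_).add (hK.smul ?_)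
    · exact_mod_cast sub_pos.2 hs1
    · exact_mod_cast hs0
  · rw [hermForm_add, hermForm_smul, hermForm_smul]

theorem lineForm_single (l : Fin n) : lineForm (Pi.basisFun ℂ (Fin n) l) = areaForm l := by
  rw [lineForm, areaForm, ← conjForm_dz, Pi.basisFun_apply]
  rfl

theorem isKahler_sum_areaForm : IsKahler (∑ l : Fin n, areaForm l) :=
  isKahler_iff.2 ⟨Pi.basisFun ℂ (Fin n), by simp only [lineForm_single]⟩

theorem pos_of_isKahler {c : Fin n → ℂ} (h : IsKahler (∑ l, c l • areaForm l)) (l : Fin n) :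
    0 < c l := by
  obtain ⟨H, hH, hc⟩ := isKahler_iff_posDef.1 h
  rw [← hermForm_diagonal] at hc
  rw [← hermForm_injective hc] at hH
  exact Matrix.posDef_diagonal_iff.1 hH l

/-! ### The deformation to the square of a Kähler form -/

/-- The matrix `(1 - s) B + s I`. -/
noncomputable def PosHerm.interp (B : PosHerm) (s : Set.Icc (0 : ℝ) 1) : PosHerm where
  a := (1 - s) * B.a + s
  d := (1 - s) * B.d + s
  u := (1 - s : ℝ) * B.u
  a_pos := by
    obtain ⟨s, hs0, hs1⟩ := s
    have := B.a_pos
    change 0 < (1 - s) * B.a + s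
    rcases hs0.eq_or_lt with rfl | hs0
    · linarith
    · nlinarith [mul_nonneg (sub_nonneg.2 hs1) this.le]
  d_pos := by
    obtain ⟨s, hs0, hs1⟩ := s
    have := B.d_pos
    change 0 < (1 - s) * B.d + s
    rcases hs0.eq_or_lt with rfl | hs0
    · linarith
    · nlinarith [mul_nonneg (sub_nonneg.2 hs1) this.le]
  normSq_lt := by
    obtain ⟨s, hs0, hs1⟩ := s
    have ha := B.a_pos
    have hd := B.d_pos
    have hu := B.normSq_lt
    rw [Complex.normSq_mul, Complex.normSq_ofReal]
    change (1 - s) * (1 - s) * Complex.normSq B.u < ((1 - s) * B.a + s) * ((1 - s) * B.d + s)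
    rcases hs0.eq_or_lt with rfl | hs0
    · linarith
    · have h1 := mul_nonneg (mul_nonneg (sub_nonneg.2 hs1) (sub_nonneg.2 hs1)) (sub_nonneg.2 hu.le)
      have h2 := mul_nonneg (mul_nonneg (sub_nonneg.2 hs1) hs0.le) (add_nonneg ha.le hd.le)
      nlinarith [mul_pos hs0 hs0]

theorem PosHerm.mixed_interp (B C : PosHerm) (s : Set.Icc (0 : ℝ) 1) :
    (B.interp s).mixed (C.interp s) =
      ((1 - s) * B.a + s) * ((1 - s) * C.d + s) + ((1 - s) * C.a + s) * ((1 - s) * B.d + s) -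
        2 * ((1 - s) ^ 2 * (B.u * conj C.u).re) := by
  simp only [mixed, interp, map_mul, Complex.conj_ofReal]
  rw [show ((1 - (s : ℝ) : ℝ) : ℂ) * B.u * (((1 - (s : ℝ) : ℝ) : ℂ) * conj C.u) =
    (((1 - (s : ℝ)) ^ 2 : ℝ) : ℂ) * (B.u * conj C.u) by push_cast; ring, Complex.re_ofReal_mul]

theorem continuous_discForm_interp (w : Fin n → Fin n → ℂ) (B : Fin n → PosHerm)
    {f : ℝ → Set.Icc (0 : ℝ) 1} (hf : Continuous f) (φ : Form n →ₗ[ℂ] ℂ) :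
    Continuous fun t => φ (discForm w fun l => (B l).interp (f t)) := by
  have hf' : Continuous fun t => (f t : ℝ) := continuous_subtype_val.comp hf
  simp only [discForm, map_smul, map_sum, PosHerm.mixed_interp, smul_eq_mul]
  fun_prop

theorem discForm_eq_sq (w : Fin n → Fin n → ℂ) {B : Fin n → PosHerm}
    (hB : ∀ k l, (B k).mixed (B l) = 2) :
    discForm w B = (∑ l, lineForm (w l)) ^ 2 := by
  rw [discForm, pow_two, Finset.sum_mul_sum, Finset.smul_sum]
  refine Finset.sum_congr rfl fun k _ => ?_
  rw [Finset.smul_sum]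
  refine Finset.sum_congr rfl fun l _ => ?_
  rw [hB, smul_smul]
  norm_num

/-- The identity matrix. -/
def PosHerm.id : PosHerm := ⟨1, 1, 0, one_pos, one_pos, by simp⟩

/-- The square of a Kähler form is the determinant of `ω` times the identity matrix. -/
theorem IsKahler.sq_eq_discForm {ω : Form n} (hω : IsKahler ω) :
    ∃ w : Module.Basis (Fin n) ℂ (Fin n → ℂ), ω ^ 2 = discForm w fun _ => PosHerm.id := by
  obtain ⟨w, rfl⟩ := isKahler_iff.1 hω
  refine ⟨w, (discForm_eq_sq _ fun _ _ => ?_).symm⟩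
  norm_num [PosHerm.mixed, PosHerm.id]

/-- In the bidegrees with `p ≤ 1` or `q ≤ 1` the determinant is Hodge-Riemann. On `[0, 1/2]` the
path moves the matrices `B_l` to the identity and ends at `ω₀²`, where `ω₀ = ∑ (√-1/2) w_l ∧ w̄_l`;
on `[1/2, 1]` it consists of the squares of the Kähler forms between `ω₀` and `ω`. -/
theorem isHodgeRiemannAt_discForm {p q : ℕ} (hpq : p + q + 2 = n) (hmin : min p q ≤ 1)
    (w : Module.Basis (Fin n) ℂ (Fin n → ℂ)) (B : Fin n → PosHerm) {ω : Form n}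
    (hω : IsKahler ω) : IsHodgeRiemannAt ω (discForm w B) 2 p q := by
  set ω₀ : Form n := ∑ l, lineForm (w l) with hω₀
  have hK₀ : IsKahler ω₀ := isKahler_iff.2 ⟨w, rfl⟩
  let f : ℝ → Set.Icc (0 : ℝ) 1 := fun t => Set.projIcc 0 1 zero_le_one (2 * t)
  let g : ℝ → Set.Icc (0 : ℝ) 1 := fun t => Set.projIcc 0 1 zero_le_one (2 * t - 1)
  let κ : ℝ → Form n := fun t => ((1 - (g t : ℝ) : ℝ) : ℂ) • ω₀ + ((g t : ℝ) : ℂ) • ω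
  have hf : Continuous f := continuous_projIcc.comp (by fun_prop)
  have hg : Continuous fun t => (g t : ℝ) :=
    continuous_subtype_val.comp (continuous_projIcc.comp (by fun_prop))
  let Ωt : ℝ → Form n := fun t =>
    if t ≤ 1 / 2 then discForm w fun l => (B l).interp (f t) else κ t ^ 2
  have hΩt : ∀ t, ∃ (v : Module.Basis (Fin n) ℂ (Fin n → ℂ)) (C : Fin n → PosHerm),
      Ωt t = discForm v C := by
    intro t
    by_cases ht : t ≤ 1 / 2
    · exact ⟨w, _, if_pos ht⟩
    · obtain ⟨v, hv⟩ := (hK₀.interp hω (g t).2).sq_eq_discForm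
      exact ⟨v, _, (if_neg ht).trans hv⟩
  refine ⟨hpq, Ωt, fun φ => Continuous.continuousOn ?_, fun t _ => ?_, ?_, ?_, fun t _ r hr => ?_⟩
  · have h1 : ∀ t, φ (Ωt t) = if t ≤ 1 / 2 then φ (discForm w fun l => (B l).interp (f t))
        else φ (κ t ^ 2) := fun t => apply_ite φ _ _ _
    simp only [h1]
    refine Continuous.if_le (continuous_discForm_interp w B hf φ) ?_ continuous_id
      continuous_const ?_
    · have h2 : ∀ t, φ (κ t ^ 2) =
          ((1 - (g t : ℝ) : ℝ) : ℂ) * (((1 - (g t : ℝ) : ℝ) : ℂ) * φ (ω₀ * ω₀)) +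
          ((g t : ℝ) : ℂ) * (((1 - (g t : ℝ) : ℝ) : ℂ) * φ (ω * ω₀)) +
          (((1 - (g t : ℝ) : ℝ) : ℂ) * (((g t : ℝ) : ℂ) * φ (ω₀ * ω)) +
          ((g t : ℝ) : ℂ) * (((g t : ℝ) : ℂ) * φ (ω * ω))) := by
        intro t
        simp only [κ, pow_two, mul_add, add_mul, smul_mul_assoc, mul_smul_comm, map_add, map_smul,
          smul_eq_mul]
        ring
      simp only [h2]
      fun_prop
    · rintro t rfl
      have hf1 : ((f (1 / 2) : Set.Icc (0 : ℝ) 1) : ℝ) = 1 := by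
        simp only [f]
        norm_num [Set.coe_projIcc]
      have hg0 : ((g (1 / 2) : Set.Icc (0 : ℝ) 1) : ℝ) = 0 := by
        simp only [g]
        norm_num [Set.coe_projIcc]
      rw [discForm_eq_sq w fun k l => by
        rw [PosHerm.mixed_interp, hf1]
        norm_num]
      simp only [κ, hg0]
      simp [hω₀]
  · obtain ⟨v, C, h⟩ := hΩt t
    rw [h]
    exact ⟨discForm_mem _ _, conjForm_discForm _ _⟩
  · have hf0 : ((f 0 : Set.Icc (0 : ℝ) 1) : ℝ) = 0 := by
      simp only [f]
      norm_num [Set.coe_projIcc]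
    simp only [Ωt]
    rw [if_pos (by norm_num)]
    unfold discForm
    simp only [PosHerm.mixed_interp, hf0]
    simp [PosHerm.mixed]
  · have hg1 : ((g 1 : Set.Icc (0 : ℝ) 1) : ℝ) = 1 := by
      simp only [g]
      norm_num [Set.coe_projIcc]
    simp only [Ωt]
    rw [if_neg (by norm_num)]
    simp only [κ, hg1]
    simp
  · obtain ⟨v, C, h⟩ := hΩt t
    rw [h]
    exact isLefschetz_discForm_mul_pow hpq hmin hr v C hω

/-! ### Griffiths positive diagonalized matrices -/

theorem formDet_two (M : Matrix (Fin 2) (Fin 2) (Form n)) :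
    formDet M = M 0 0 * M 1 1 - M 0 1 * M 1 0 := by
  have h : (Finset.univ : Finset (Equiv.Perm (Fin 2))) = {1, Equiv.swap 0 1} := by decide
  rw [formDet, h, Finset.sum_insert (by decide), Finset.sum_singleton]
  simp [sub_eq_add_neg]

/-- The determinant of a Griffiths positive diagonalized matrix `∑ B_l V_l`: evaluation on suitable
vectors `θ` shows that the matrices `B_l` are positive definite. -/
theorem exists_formDet_eq_discForm {M : Matrix (Fin 2) (Fin 2) (Form n)}
    (hM : IsGriffithsPositive M) (hdiag : HasDiagonalizedEntries M) :
    ∃ B : Fin n → PosHerm, formDet M = discForm (Pi.basisFun ℂ (Fin n)) B := by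
  obtain ⟨b, hb⟩ := hdiag
  have hherm : ∀ i j l, b i j l = conj (b j i l) := by
    intro i j l
    have h1 := hM.hermitian i j
    simp only [hb, map_sum, conjForm_smul, conjForm_areaForm] at h1
    rw [← hermForm_diagonal, ← hermForm_diagonal] at h1
    exact congrFun (Matrix.diagonal_injective (hermForm_injective h1)) l
  have hpos : ∀ θ : Fin 2 → ℂ, θ ≠ 0 → ∀ l, 0 < ∑ i, ∑ j, (θ i * conj (θ j)) * b i j l := by
    intro θ hθ l
    have h1 := hM.kahler θ hθ
    refine pos_of_isKahler (c := fun l => ∑ i, ∑ j, (θ i * conj (θ j)) * b i j l) ?_ l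
    convert h1 using 1
    simp only [hb, Finset.smul_sum, Finset.sum_smul, smul_smul]
    rw [Finset.sum_comm]
    refine Finset.sum_congr rfl fun i _ => ?_
    rw [Finset.sum_comm]
  have ha : ∀ l, 0 < b 0 0 l := by
    intro l
    have h1 := hpos ![1, 0] (fun h => one_ne_zero (congrFun h 0)) l
    simpa [Fin.sum_univ_two] using h1
  have hd : ∀ l, 0 < b 1 1 l := by
    intro l
    have h1 := hpos ![0, 1] (fun h => one_ne_zero (congrFun h 1)) l
    simpa [Fin.sum_univ_two] using h1
  have hare : ∀ l, b 0 0 l = ((b 0 0 l).re : ℂ) := fun l => Complex.eq_re_of_ofReal_le (ha l).le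
  have hdre : ∀ l, b 1 1 l = ((b 1 1 l).re : ℂ) := fun l => Complex.eq_re_of_ofReal_le (hd l).le
  have hapos : ∀ l, 0 < (b 0 0 l).re := fun l => (Complex.lt_def.1 (ha l)).1
  have hdpos : ∀ l, 0 < (b 1 1 l).re := fun l => (Complex.lt_def.1 (hd l)).1
  have hu : ∀ l, Complex.normSq (b 0 1 l) < (b 0 0 l).re * (b 1 1 l).re := by
    intro l
    -- For `θ = (d, -u)` the value is `d (a d - |u|²)`.
    have h1 := hpos ![b 1 1 l, -b 0 1 l] (fun h => (hd l).ne' (congrFun h 0)) l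
    have h2 : ∑ i, ∑ j, (![b 1 1 l, -b 0 1 l] i * conj (![b 1 1 l, -b 0 1 l] j)) * b i j l =
        (((b 1 1 l).re * ((b 0 0 l).re * (b 1 1 l).re - Complex.normSq (b 0 1 l)) : ℝ) : ℂ) := by
      simp only [Fin.sum_univ_two, Matrix.cons_val_zero, Matrix.cons_val_one]
      rw [hherm 1 0 l]
      push_cast
      rw [Complex.normSq_eq_conj_mul_self, ← hare, ← hdre]
      have h3 : conj (b 1 1 l) = b 1 1 l := (hherm 1 1 l).symm
      rw [map_neg, h3]
      ring
    rw [h2] at h1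
    have h3 : 0 < (b 1 1 l).re * ((b 0 0 l).re * (b 1 1 l).re - Complex.normSq (b 0 1 l)) := by
      exact_mod_cast h1
    have := (mul_pos_iff_of_pos_left (hdpos l)).1 h3
    linarith
  refine ⟨fun l => ⟨(b 0 0 l).re, (b 1 1 l).re, b 0 1 l, hapos l, hdpos l, hu l⟩, ?_⟩
  have hmixed : ∀ k l : Fin n, ((PosHerm.mixed
      ⟨(b 0 0 k).re, (b 1 1 k).re, b 0 1 k, hapos k, hdpos k, hu k⟩
      ⟨(b 0 0 l).re, (b 1 1 l).re, b 0 1 l, hapos l, hdpos l, hu l⟩ : ℝ) : ℂ) =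
      (b 0 0 k * b 1 1 l - b 0 1 k * b 1 0 l) + (b 0 0 l * b 1 1 k - b 0 1 l * b 1 0 k) := by
    intro k l
    have h6 := Complex.add_conj (b 0 1 k * conj (b 0 1 l))
    rw [map_mul, Complex.conj_conj] at h6
    unfold PosHerm.mixed
    push_cast at h6 ⊢
    rw [← hare, ← hare, ← hdre, ← hdre, hherm 1 0 k, hherm 1 0 l]
    linear_combination h6
  have hdet : formDet M = ∑ k, ∑ l, (b 0 0 k * b 1 1 l - b 0 1 k * b 1 0 l) •
      (areaForm k * areaForm l) := by
    rw [formDet_two]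
    simp only [hb, Finset.sum_mul_sum, smul_mul_smul_comm, sub_smul, Finset.sum_sub_distrib]
  have hdet' : formDet M = ∑ k, ∑ l, (b 0 0 l * b 1 1 k - b 0 1 l * b 1 0 k) •
      (areaForm k * areaForm l) := by
    rw [hdet, Finset.sum_comm]
    refine Finset.sum_congr rfl fun k _ => Finset.sum_congr rfl fun l _ => ?_
    rw [← lineForm_single k, mul_comm_of_mem_diag (lineForm_mem _)]
  simp only [discForm, lineForm_single, hmixed, add_smul, Finset.sum_add_distrib]
  rw [← hdet, ← hdet', ← two_smul ℂ, smul_smul]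
  norm_num

end ConstForm

open ConstForm
theorem mainTheorem2 (n : ℕ) (hn : 2 ≤ n) (M : Matrix (Fin 2) (Fin 2) (Form n))
    (hM : IsGriffithsPositive M) (hdiag : HasDiagonalizedEntries M) :
    (n ≤ 5 → ∀ ω : Form n, IsKahler ω →
      (∀ p q : ℕ, p + q + 2 = n →
        IsLefschetz (formDet M) p q ∧ SatisfiesHRR (formDet M) ω p q ∧
          SatisfiesLD (formDet M) ω p q) ∧
      IsHodgeRiemann ω (formDet M) 2) ∧
    (4 ≤ n →
      IsLefschetz (formDet M) (n - 2) 0 ∧ IsLefschetz (formDet M) (n - 3) 1 ∧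
        IsLefschetz (formDet M) 1 (n - 3) ∧ IsLefschetz (formDet M) 0 (n - 2)) := by
  obtain ⟨B, hB⟩ := exists_formDet_eq_discForm hM hdiag
  rw [hB]
  refine ⟨fun hn5 ω hω => ⟨fun p q hpq => ?_, ⟨discForm_mem _ _, conjForm_discForm _ _⟩,
    fun p q hpq => ?_⟩, fun hn4 => ?_⟩
  · exact hodgeRiemann_discForm hpq (by omega) _ B hω
  · exact isHodgeRiemannAt_discForm hpq (by omega) _ B hω
  · have h : ∀ p q, p + q + 2 = n → min p q ≤ 1 →
        IsLefschetz (discForm (Pi.basisFun ℂ (Fin n)) B) p q := fun p q hpq hmin =>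
      (hodgeRiemann_discForm hpq hmin _ B isKahler_sum_areaForm).1
    exact ⟨h _ _ (by omega) (by omega), h _ _ (by omega) (by omega), h _ _ (by omega) (by omega),
      h _ _ (by omega) (by omega)⟩
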